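/- Let $d, r \ge 1$ be integers, let $\alpha_1, \dots, \alpha_r \in \mathbb{R}^d$, let $\xi_1, \dots, \xi_r$ be $\mathbb{Z}$-valued random variables and let $I$ be a $\{1, \dots, r\}$-valued random variable, with $\xi_1, \dots, \xi_r, I$ independent. Let $\nu$ be the distribution of $\xi_I \alpha_I + \mathbb{Z}^d$ on the torus $\mathbb{R}^d/\mathbb{Z}^d$, let $\nu^{*k}$ be its $k$-fold convolution, and let $\mu$ be the normalized Haar measure on the torus. For Borel probability measures $\nu_1, \nu_2$ on the torus let $$W_1(\nu_1, \nu_2) = \inf_{\vartheta} \int |x-y| \, \mathrm{d}\vartheta(x,y),$$ where $|x-y|$ is the Euclidean distance on $\mathbb{R}^d/\mathbb{Z}^d$ and $\vartheta$ runs over all couplings of $\nu_1$ and $\nu_2$. Let $\|\cdot\|_{\mathbb{R}/\mathbb{Z}}$ denote the distance from the nearest integer. Assume that every $\xi_i$ is nondegenerate (not almost surely constant) and that $\Pr(I=i)>0$ for all $1 \le i \le r$. Let $\psi : [1,\infty) \to (0,\infty)$ be a function such that $\psi(x) x^{-d/r}$ is nondecreasing and $$K := \inf_{h \in \mathbb{Z}^d,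 \, h \ne 0} \left( \max_{1 \le i \le r} \| \langle h, \alpha_i \rangle \|_{\mathbb{R}/\mathbb{Z}} \cdot \psi(\|h\|_\infty) \right) > 0 .$$ Then for every integer $k \ge 1$, $$W_1(\nu^{*k}, \mu) \ll \frac{1}{\psi^{-1}(\sqrt{k})}, \qquad \psi^{-1}(y) := \sup \{ x \ge 1 : \psi(x) \le y \},$$ where the supremum is taken in $[1,\infty)$, i.e. it is $1$ for the empty set. The implied constant depends only on the distributions of $\xi_1, \dots, \xi_r, I$, on $K$, $d$ and $r$. In particular, if $\alpha_1, \dots, \alpha_r$ is badly approximable, i.e. if $K>0$ for $\psi(x) = x^{d/r}$, then $W_1(\nu^{*k}, \mu) \ll k^{-r/(2d)}$ for every integer $k \ge 1$, with an implied constant depending only on the same data (with $K$ the infimum for $\psi(x)=x^{d/r}$). -/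

import Mathlib

open MeasureTheory ProbabilityTheory
open scoped MeasureTheory

noncomputable section

namespace LatticeWalk

/-- The canonical projection `ℝ^d → ℝ^d / ℤ^d`, `x ↦ x + ℤ^d`. -/
def toTorus {d : ℕ} (x : Fin d → ℝ) : UnitAddTorus (Fin d) := fun j => (x j : UnitAddCircle)

/-- The Euclidean metric on `ℝ^d / ℤ^d`. (Mathlib's default metric on this type is the maximum
metric; the norm on `UnitAddCircle` is the distance from the nearest integer.) -/
def euclDist {d : ℕ} (x y : UnitAddTorus (Fin d)) : ℝ := Real.sqrt (∑ j, ‖x j - y j‖ ^ 2)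

/-- The set of couplings of two measures on the torus: Borel probability measures on the product
space with the given marginals. -/
def couplings {d : ℕ} (ν₁ ν₂ : Measure (UnitAddTorus (Fin d))) :
    Set (Measure (UnitAddTorus (Fin d) × UnitAddTorus (Fin d))) :=
  {θ | IsProbabilityMeasure θ ∧ θ.fst = ν₁ ∧ θ.snd = ν₂}

/-- The `1`-Wasserstein distance on the torus with respect to the Euclidean metric: the infimum of
the transport cost over all couplings. -/
def W1 {d : ℕ} (ν₁ ν₂ : Measure (UnitAddTorus (Fin d))) : ℝ :=
  sInf ((fun θ => ∫ z, euclDist z.1 z.2 ∂θ) '' couplings ν₁ ν₂)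

/-- The `k`-fold convolution `ν * ⋯ * ν` of a measure on the torus. -/
def convPow {d : ℕ} (ν : Measure (UnitAddTorus (Fin d))) : ℕ → Measure (UnitAddTorus (Fin d))
  | 0 => Measure.dirac 0
  | k + 1 => (convPow ν k).conv ν

/-- The infimum over nonzero `h ∈ ℤ^d` of `max_i ‖⟨h, α_i⟩‖_{ℝ/ℤ} · ψ(‖h‖_∞)`. (The norm on
`Fin d → ℤ` is the maximum norm.) -/
def diophInf {d r : ℕ} (α : Fin r → Fin d → ℝ) (ψ : ℝ → ℝ) : ℝ :=
  ⨅ h : {h : Fin d → ℤ // h ≠ 0},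
    (⨆ i : Fin r, ‖((∑ j, (h.1 j : ℝ) * α i j : ℝ) : UnitAddCircle)‖) * ψ ‖h.1‖

/-- A system of vectors is badly approximable if the Diophantine condition holds with
`ψ(x) = x^(d/r)`. -/
def IsBadlyApproximable {d r : ℕ} (α : Fin r → Fin d → ℝ) : Prop :=
  0 < diophInf α (fun x => x ^ ((d : ℝ) / r))

/-- The generalized inverse `ψ⁻¹(y) = sup {x ≥ 1 : ψ(x) ≤ y}`. The supremum is taken in `[1, ∞)`,
so that it is `1` if there is no such `x`. -/
def genInv (ψ : ℝ → ℝ) (y : ℝ) : ℝ := sSup (insert 1 {x : ℝ | 1 ≤ x ∧ ψ x ≤ y})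

end LatticeWalk

end

/-!
The proof has an analytic and an arithmetic half.

**Smoothing.** For a probability measure `ρ` on the torus, `transportCost_volume_le` bounds the
transport cost to the Haar measure by `2⁻ᴶ` plus a sum over the dyadic scales `2ʲ⁻ᴶ` of the scale
times the `ℓ²` norm of the nontrivial Fourier coefficients of `ρ` up to frequency `~ 2ᴶ⁻ʲ`. Couplings
are constructed directly, without Kantorovich duality. Convolve `ρ` successively with kernels of
Jackson type (`torusKernel`) at the scales `2⁻ᴶ, 2¹⁻ᴶ, …, 1`, the last of which is the Haar measure.
After the first step the measure differs from the Haar measure by a signed trigonometric polynomial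
`u`, and a further convolution at scale `s` costs at most `s ‖u‖₁ ≤ s ‖u‖₂`, because only the parts
`u⁺` and `u⁻` have to be moved (`transportCost_conv_le_of_add_eq`). What makes this work is that a
common summand of two measures can be cancelled from their transport cost
(`transportCost_le_add_right`).

**Gaussian sums.** A nondegenerate distribution on `ℤ` has two atoms, whence the Fourier coefficients
of the step satisfy `|ν̂(h)| ≤ exp (-c ∑ i, ‖L ⟨h, α_i⟩‖²)` for a fixed `L`
(`exists_norm_sum_charInt_le`, `charCoeff_step`). By the Diophantine condition the points
`(L ⟨h, α_i⟩)_i` with `|h| ≤ H` are separated by `δ = K / ψ(2LH)`, so a sum of Gaussians over them is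
a convergent sum over the cells of a grid (`sum_exp_le_of_separated`). For the `k`-th convolution
power this gives `∑ |ν̂(h)|²ᵏ ≪ (2LH / M)⁴` over `0 < |h| < H`, where `ψ M ≤ √k` and `2LH ≤ M`
(`sum_freqBox_exp_le`); the monotonicity of `ψ x * x ^ (-d / r)` turns the distance of `H` from the
critical scale `M` into decay. With `2ᴶ` of order `M` the sum over the scales in the smoothing
inequality is then of order `1 / M`.
-/

noncomputable section

namespace LatticeWalk

open scoped ENNReal ComplexConjugate
open UnitAddTorus

/-! ### Optimal transport cost of finite measures -/

section TransportCost

variable {X : Type*} [MetricSpace X] [MeasurableSpace X]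

/-- The optimal transport cost between two measures of equal mass with respect to the extended
distance. It is `∞` if there is no coupling. -/
def transportCost (a b : Measure X) : ℝ≥0∞ :=
  ⨅ θ : {θ : Measure (X × X) // θ.fst = a ∧ θ.snd = b}, ∫⁻ z, edist z.1 z.2 ∂θ.1

lemma transportCost_le {a b : Measure X} (θ : Measure (X × X)) (h1 : θ.fst = a)
    (h2 : θ.snd = b) : transportCost a b ≤ ∫⁻ z, edist z.1 z.2 ∂θ :=
  iInf_le (fun θ : {θ : Measure (X × X) // θ.fst = a ∧ θ.snd = b} =>
    ∫⁻ z, edist z.1 z.2 ∂θ.1) ⟨θ, h1, h2⟩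

lemma transportCost_add_le (a b a' b' : Measure X) :
    transportCost (a + a') (b + b') ≤ transportCost a b + transportCost a' b' := by
  unfold transportCost
  rw [ENNReal.iInf_add]
  refine le_iInf fun ⟨θ, h1, h2⟩ => ?_
  rw [ENNReal.add_iInf]
  refine le_iInf fun ⟨θ', h1', h2'⟩ => ?_
  subst h1 h2 h1' h2'
  refine (transportCost_le (θ + θ') ?_ ?_).trans_eq ?_
  · exact Measure.map_add _ _ measurable_fst
  · exact Measure.map_add _ _ measurable_snd
  · exact lintegral_add_measure _ _ _

lemma transportCost_smul_le (t : ℝ≥0∞) (a b : Measure X) (ht : t ≠ 0) (ht' : t ≠ ∞) :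
    transportCost (t • a) (t • b) ≤ t * transportCost a b := by
  unfold transportCost
  rw [ENNReal.mul_iInf_of_ne ht ht']
  refine le_iInf fun ⟨θ, h1, h2⟩ => ?_
  subst h1 h2
  refine (transportCost_le (t • θ) ?_ ?_).trans_eq ?_
  · exact Measure.map_smul _ _ _
  · exact Measure.map_smul _ _ _
  · exact lintegral_smul_measure _ _

variable [BorelSpace X] [SecondCountableTopology X]

lemma transportCost_map_le {Y : Type*} [MeasurableSpace Y] (m : Measure Y) {f g : Y → X}
    (hf : Measurable f) (hg : Measurable g) :
    transportCost (m.map f) (m.map g) ≤ ∫⁻ y, edist (f y) (g y) ∂m := by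
  refine (transportCost_le (m.map fun y => (f y, g y)) ?_ ?_).trans ?_
  · exact Measure.fst_map_prodMk hg
  · exact Measure.snd_map_prodMk hf
  · rw [lintegral_map (by fun_prop) (by fun_prop)]

lemma transportCost_self (a : Measure X) : transportCost a a = 0 := by
  have h := transportCost_map_le a (measurable_id (α := X)) measurable_id
  simpa using h

lemma transportCost_comm (a b : Measure X) : transportCost a b = transportCost b a := by
  have key (a b : Measure X) : transportCost a b ≤ transportCost b a := by
    refine le_iInf fun ⟨θ, h1, h2⟩ => ?_
    subst h1 h2
    refine (transportCost_map_le θ measurable_snd measurable_fst).trans_eq ?_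
    simp_rw [edist_comm]
  exact le_antisymm (key a b) (key b a)

lemma transportCost_add_right_le (a b c : Measure X) :
    transportCost (a + c) (b + c) ≤ transportCost a b := by
  simpa [transportCost_self] using transportCost_add_le a b c c

/-- The triangle inequality, obtained by gluing two couplings along their common marginal. -/
lemma transportCost_triangle [StandardBorelSpace X] [Nonempty X] (a b c : Measure X)
    [IsFiniteMeasure b] :
    transportCost a c ≤ transportCost a b + transportCost b c := by
  unfold transportCost
  rw [ENNReal.iInf_add]
  refine le_iInf fun ⟨θ, h1, h2⟩ => ?_
  rw [ENNReal.add_iInf]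
  refine le_iInf fun ⟨η, h3, h4⟩ => ?_
  have hη : IsFiniteMeasure η := ⟨by
    rw [← Measure.fst_univ, h3]; exact measure_lt_top _ _⟩
  have hθ : IsFiniteMeasure θ := ⟨by
    rw [← Measure.snd_univ, h2]; exact measure_lt_top _ _⟩
  -- conditionally on the middle point, the two end points are independent
  set κ : Kernel (X × X) X := η.condKernel.comap Prod.snd measurable_snd with hκ
  set γ : Measure ((X × X) × X) := θ ⊗ₘ κ with hγ
  have hγ1 : γ.map Prod.fst = θ := Measure.fst_compProd θ κ
  have hγ2 : γ.map (fun z => (z.1.2, z.2)) = η := by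
    conv_rhs => rw [← Measure.disintegrate η η.condKernel, h3, ← h2]
    ext s hs
    rw [Measure.map_apply (by fun_prop) hs, hγ,
      Measure.compProd_apply (measurableSet_preimage (by fun_prop) hs),
      Measure.compProd_apply hs, Measure.snd,
      lintegral_map (Kernel.measurable_kernel_prodMk_left hs) measurable_snd]
    rfl
  have e1 : a = γ.map (fun z => z.1.1) := by
    rw [← h1, Measure.fst, ← hγ1, Measure.map_map measurable_fst measurable_fst]; rfl
  have e2 : c = γ.map (fun z => z.2) := by
    rw [← h4, Measure.snd, ← hγ2, Measure.map_map measurable_snd (by fun_prop)]; rfl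
  change transportCost a c ≤ (∫⁻ z, edist z.1 z.2 ∂θ) + ∫⁻ z, edist z.1 z.2 ∂η
  rw [e1, e2]
  refine (transportCost_map_le γ (by fun_prop) (by fun_prop)).trans ?_
  have i1 : ∫⁻ z, edist z.1 z.2 ∂θ = ∫⁻ z, edist z.1.1 z.1.2 ∂γ := by
    rw [← hγ1, lintegral_map (by fun_prop) measurable_fst]
  have i2 : ∫⁻ z, edist z.1 z.2 ∂η = ∫⁻ z, edist z.1.2 z.2 ∂γ := by
    rw [← hγ2, lintegral_map (by fun_prop) (by fun_prop)]
  rw [i1, i2, ← lintegral_add_left (by fun_prop)]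
  exact lintegral_mono fun z => edist_triangle _ _ _

/-- The independent coupling, rescaled to have the right marginals, bounds the cost by the
diameter times the mass. -/
lemma transportCost_le_diam (a b : Measure X) [IsFiniteMeasure a] [IsFiniteMeasure b]
    (hab : a Set.univ = b Set.univ) {D : ℝ≥0∞} (hD : ∀ x y : X, edist x y ≤ D) :
    transportCost a b ≤ D * a Set.univ := by
  by_cases h0 : a Set.univ = 0
  · have ha : a = 0 := Measure.measure_univ_eq_zero.mp h0
    have hb : b = 0 := Measure.measure_univ_eq_zero.mp (hab ▸ h0)
    simp [ha, hb, transportCost_self]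
  have hfin : a Set.univ ≠ ∞ := measure_ne_top _ _
  refine (transportCost_le ((a Set.univ)⁻¹ • a.prod b) ?_ ?_).trans ?_
  · rw [Measure.fst, Measure.map_smul, Measure.map_fst_prod, smul_smul, ← hab,
      ENNReal.inv_mul_cancel h0 hfin, one_smul]
  · rw [Measure.snd, Measure.map_smul, Measure.map_snd_prod, smul_smul,
      ENNReal.inv_mul_cancel h0 hfin, one_smul]
  · rw [lintegral_smul_measure]
    calc _ ≤ (a Set.univ)⁻¹ • ∫⁻ _, D ∂(a.prod b) := by
          gcongr; exact hD _ _
      _ = D * a Set.univ := by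
          rw [lintegral_const, ← Set.univ_prod_univ, Measure.prod_prod, ← hab, smul_eq_mul]
          calc _ = ((a Set.univ)⁻¹ * a Set.univ) * (D * a Set.univ) := by ring
            _ = _ := by rw [ENNReal.inv_mul_cancel h0 hfin, one_mul]

lemma transportCost_nsmul_add_le [StandardBorelSpace X] [Nonempty X] (a b c : Measure X)
    [IsFiniteMeasure a] [IsFiniteMeasure b] [IsFiniteMeasure c] (n : ℕ) :
    transportCost ((n : ℝ≥0∞) • a + c) ((n : ℝ≥0∞) • b + c) ≤
      n * transportCost (a + c) (b + c) := by
  induction n with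
  | zero => simp [transportCost_self]
  | succ n ih =>
    have e1 : ((n + 1 : ℕ) : ℝ≥0∞) • a + c = (a + c) + (n : ℝ≥0∞) • a := by
      push_cast; rw [add_smul, one_smul]; abel
    have e2 : ((n + 1 : ℕ) : ℝ≥0∞) • b + c = ((n : ℝ≥0∞) • b + c) + b := by
      push_cast; rw [add_smul, one_smul]; abel
    have e3 : (b + c) + (n : ℝ≥0∞) • a = ((n : ℝ≥0∞) • a + c) + b := by abel
    have hf : IsFiniteMeasure ((b + c) + (n : ℝ≥0∞) • a) := by
      have := Measure.smul_finite a (ENNReal.natCast_ne_top n)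
      infer_instance
    rw [e1, e2]
    refine (transportCost_triangle _ ((b + c) + (n : ℝ≥0∞) • a) _).trans ?_
    push_cast
    rw [add_mul, one_mul, add_comm]
    refine add_le_add ?_ (transportCost_add_right_le _ _ _)
    rw [e3]
    exact (transportCost_add_right_le _ _ _).trans ih

/-- **Cancellation**: adding the same measure to both sides does not decrease the transport cost.
Exchanging `a` for `b` one copy at a time moves `n • a + c` to `n • b + c` at `n` times the cost,
and for large `n` the contribution of `c` is negligible. -/
lemma transportCost_le_add_right [StandardBorelSpace X] [Nonempty X] (a b c : Measure X)
    [IsProbabilityMeasure a] [IsProbabilityMeasure b] [IsFiniteMeasure c] {D : ℝ≥0∞}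
    (hD' : D ≠ ∞) (hD : ∀ x y : X, edist x y ≤ D) :
    transportCost a b ≤ transportCost (a + c) (b + c) := by
  set ε := transportCost (a + c) (b + c) with hε
  set τ := c Set.univ with hτ
  have hτ' : τ ≠ ∞ := measure_ne_top _ _
  have key (n : ℕ) (hn : n ≠ 0) : transportCost a b ≤ ε + (2 * D * τ) * (n : ℝ≥0∞)⁻¹ := by
    have hna := Measure.smul_finite a (ENNReal.natCast_ne_top n)
    have hnb := Measure.smul_finite b (ENNReal.natCast_ne_top n)
    have hta := Measure.smul_finite a hτ'
    have htb := Measure.smul_finite b hτ'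
    set N : ℝ≥0∞ := n + τ with hN
    have hN0 : N ≠ 0 := by simp [hN, hn]
    have hN' : N ≠ ∞ := by simp [hN, hτ']
    have h1 : transportCost (N • a) (N • b) ≤ n * ε + 2 * D * τ := by
      have s1 : transportCost (N • a) ((n : ℝ≥0∞) • a + c) ≤ D * τ := by
        rw [hN, add_smul, add_comm, add_comm _ c]
        refine (transportCost_add_right_le _ _ _).trans ?_
        refine (transportCost_le_diam _ _ (by simp [hτ]) hD).trans_eq (by simp)
      have s2 : transportCost ((n : ℝ≥0∞) • b + c) (N • b) ≤ D * τ := by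
        rw [hN, add_smul, add_comm, add_comm _ (τ • b)]
        refine (transportCost_add_right_le _ _ _).trans ?_
        refine (transportCost_le_diam _ _ (by simp [hτ]) hD).trans_eq (by simp [hτ])
      calc _ ≤ transportCost (N • a) ((n : ℝ≥0∞) • a + c)
              + transportCost ((n : ℝ≥0∞) • a + c) (N • b) := transportCost_triangle _ _ _
        _ ≤ transportCost (N • a) ((n : ℝ≥0∞) • a + c)
              + (transportCost ((n : ℝ≥0∞) • a + c) ((n : ℝ≥0∞) • b + c)
                + transportCost ((n : ℝ≥0∞) • b + c) (N • b)) := by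
            gcongr; exact transportCost_triangle _ _ _
        _ ≤ D * τ + (n * ε + D * τ) := by
            gcongr; exact transportCost_nsmul_add_le a b c n
        _ = _ := by ring
    have h2 : transportCost a b ≤ N⁻¹ * transportCost (N • a) (N • b) := by
      have := transportCost_smul_le N⁻¹ (N • a) (N • b) (ENNReal.inv_ne_zero.mpr hN')
        (ENNReal.inv_ne_top.mpr hN0)
      rwa [smul_smul, smul_smul, ENNReal.inv_mul_cancel hN0 hN', one_smul, one_smul] at this
    have hnN : N⁻¹ ≤ (n : ℝ≥0∞)⁻¹ := ENNReal.inv_le_inv.mpr (by simp [hN])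
    calc _ ≤ N⁻¹ * (n * ε + 2 * D * τ) := h2.trans (by gcongr)
      _ ≤ (n : ℝ≥0∞)⁻¹ * (n * ε + 2 * D * τ) := by gcongr
      _ = ((n : ℝ≥0∞)⁻¹ * n) * ε + (2 * D * τ) * (n : ℝ≥0∞)⁻¹ := by ring
      _ = _ := by
        rw [ENNReal.inv_mul_cancel (by simpa using hn) (ENNReal.natCast_ne_top n), one_mul]
  have lim : Filter.Tendsto (fun n : ℕ => ε + (2 * D * τ) * (n : ℝ≥0∞)⁻¹) Filter.atTop
      (nhds (ε + (2 * D * τ) * 0)) :=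
    (ENNReal.Tendsto.const_mul ENNReal.tendsto_inv_nat_nhds_zero (Or.inr
      (ENNReal.mul_ne_top (ENNReal.mul_ne_top (by simp) hD') hτ'))).const_add ε
  rw [mul_zero, add_zero] at lim
  exact ge_of_tendsto lim (Filter.eventually_atTop.mpr ⟨1, fun n hn => key n (by omega)⟩)

end TransportCost

/-! ### Transport by random translations -/

section Convolution

variable {G : Type*} [NormedAddCommGroup G] [MeasurableSpace G] [BorelSpace G]
  [SecondCountableTopology G]

/-- The average displacement of a random translation with distribution `κ`. -/
def displacement (κ : Measure G) : ℝ≥0∞ := ∫⁻ y, ‖y‖ₑ ∂κ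

lemma transportCost_conv_le (a κ : Measure G) [IsFiniteMeasure a] [IsProbabilityMeasure κ] :
    transportCost a (a.conv κ) ≤ displacement κ * a Set.univ := by
  have h := transportCost_map_le (a.prod κ) (f := Prod.fst) (g := fun z => z.1 + z.2)
    (by fun_prop) (by fun_prop)
  have e : (a.prod κ).map Prod.fst = a := by
    simp
  rw [e] at h
  refine h.trans_eq ?_
  rw [lintegral_prod _ (by fun_prop)]
  simp [edist_eq_enorm_sub, displacement]

/-- A measure that deviates little from a `κ`-invariant measure is cheaply transported to its
convolution with `κ`: by cancellation, only the deviation has to be moved. -/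
lemma transportCost_conv_le_of_add_eq [StandardBorelSpace G] (ρ μ κ p m : Measure G)
    [IsProbabilityMeasure ρ] [IsProbabilityMeasure μ] [IsProbabilityMeasure κ]
    [IsFiniteMeasure p] [IsFiniteMeasure m] {D : ℝ≥0∞} (hD' : D ≠ ∞)
    (hD : ∀ x y : G, edist x y ≤ D) (hμ : μ.conv κ = μ) (h : ρ + m = μ + p) :
    transportCost ρ (ρ.conv κ) ≤ displacement κ * (p Set.univ + m Set.univ) := by
  have h' : ρ.conv κ + m.conv κ = μ + p.conv κ := by
    rw [← Measure.add_conv, h, Measure.add_conv, hμ]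
  refine (transportCost_le_add_right _ _ (m + m.conv κ) hD' hD).trans ?_
  have e1 : ρ + (m + m.conv κ) = μ + (p + m.conv κ) := by
    rw [← add_assoc, h, add_assoc]
  have e2 : ρ.conv κ + (m + m.conv κ) = μ + (p.conv κ + m) := by
    rw [add_comm m, ← add_assoc, h', add_assoc]
  rw [e1, e2]
  calc _ ≤ transportCost μ μ + (transportCost p (p.conv κ) + transportCost (m.conv κ) m) :=
        (transportCost_add_le _ _ _ _).trans (by gcongr; exact transportCost_add_le _ _ _ _)
    _ ≤ 0 + (displacement κ * p Set.univ + displacement κ * m Set.univ) := by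
        rw [transportCost_self, transportCost_comm (m.conv κ)]
        gcongr <;> exact transportCost_conv_le _ _
    _ = _ := by ring

end Convolution

/-! ### Fourier coefficients of measures on the torus -/

section Fourier

variable {ι : Type*} [Fintype ι]

instance : IsProbabilityMeasure (volume : Measure UnitAddCircle) := ⟨by simp⟩

/-- The Fourier coefficient `∫ e(⟨h, x⟩) dρ(x)` of a measure on the torus. -/
def charCoeff (ρ : Measure (UnitAddTorus ι)) (h : ι → ℤ) : ℂ := ∫ x, mFourier h x ∂ρ

lemma norm_mFourier_apply (h : ι → ℤ) (x : UnitAddTorus ι) : ‖mFourier h x‖ = 1 := by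
  simp only [mFourier, ContinuousMap.coe_mk, fourier_apply, norm_prod, Circle.norm_coe,
    Finset.prod_const_one]

lemma mFourier_apply_add (h : ι → ℤ) (x y : UnitAddTorus ι) :
    mFourier h (x + y) = mFourier h x * mFourier h y := by
  simp [mFourier, fourier_apply, Finset.prod_mul_distrib, AddCircle.toCircle_add]

lemma integrable_continuousMap (ρ : Measure (UnitAddTorus ι)) [IsFiniteMeasure ρ]
    (f : C(UnitAddTorus ι, ℂ)) : Integrable f ρ :=
  (integrable_const (‖f‖ : ℝ)).mono' f.continuous.aestronglyMeasurable
    (Filter.Eventually.of_forall f.norm_coe_le_norm)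

lemma norm_charCoeff_le_one (ρ : Measure (UnitAddTorus ι)) [IsProbabilityMeasure ρ]
    (h : ι → ℤ) : ‖charCoeff ρ h‖ ≤ 1 := by
  refine (norm_integral_le_integral_norm _).trans ?_
  simp [norm_mFourier_apply]

lemma charCoeff_zero (ρ : Measure (UnitAddTorus ι)) [IsProbabilityMeasure ρ] :
    charCoeff ρ 0 = 1 := by
  simp [charCoeff, mFourier_zero]

lemma charCoeff_neg (ρ : Measure (UnitAddTorus ι)) (h : ι → ℤ) :
    charCoeff ρ (-h) = conj (charCoeff ρ h) := by
  simp_rw [charCoeff, mFourier_neg]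
  exact integral_conj

lemma charCoeff_conv (a b : Measure (UnitAddTorus ι)) [IsFiniteMeasure a] [IsFiniteMeasure b]
    (h : ι → ℤ) : charCoeff (a.conv b) h = charCoeff a h * charCoeff b h := by
  unfold charCoeff
  rw [integral_conv (integrable_continuousMap _ _)]
  simp_rw [mFourier_apply_add, integral_const_mul, integral_mul_const]

lemma charCoeff_add (a b : Measure (UnitAddTorus ι)) [IsFiniteMeasure a] [IsFiniteMeasure b]
    (h : ι → ℤ) : charCoeff (a + b) h = charCoeff a h + charCoeff b h :=
  integral_add_measure (integrable_continuousMap _ _) (integrable_continuousMap _ _)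

lemma integral_fourier_volume (n : ℤ) :
    ∫ x : UnitAddCircle, fourier n x = if n = 0 then 1 else 0 := by
  split_ifs with hn
  · simp [hn]
  · exact integral_eq_zero_of_add_right_eq_neg (μ := volume)
      (fourier_add_half_inv_index hn one_pos)

lemma charCoeff_volume (h : ι → ℤ) :
    charCoeff (volume : Measure (UnitAddTorus ι)) h = if h = 0 then 1 else 0 := by
  have e : charCoeff (volume : Measure (UnitAddTorus ι)) h
      = ∏ i, ∫ x : UnitAddCircle, fourier (h i) x :=
    integral_fintype_prod_volume_eq_prod (fun i (x : UnitAddCircle) => (fourier (h i) x : ℂ))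
  rw [e]
  simp_rw [integral_fourier_volume]
  split_ifs with h0
  · simp [h0]
  · obtain ⟨i, hi⟩ := Function.ne_iff.mp h0
    exact Finset.prod_eq_zero (Finset.mem_univ i) (by simpa using hi)

lemma continuous_integral_continuousMap (ρ : Measure (UnitAddTorus ι)) [IsFiniteMeasure ρ] :
    Continuous fun f : C(UnitAddTorus ι, ℂ) => ∫ x, f x ∂ρ := by
  have e : (fun f : C(UnitAddTorus ι, ℂ) => ∫ x, f x ∂ρ) =
      fun f => ∫ x, (ContinuousMap.toLp 1 ρ ℂ f : UnitAddTorus ι → ℂ) x ∂ρ := by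
    ext f
    exact integral_congr_ae (ContinuousMap.coeFn_toLp ρ f).symm
  rw [e]
  exact continuous_integral.comp (ContinuousMap.toLp 1 ρ ℂ).continuous

/-- A finite measure on the torus is determined by its Fourier coefficients. -/
lemma measure_ext_charCoeff {a b : Measure (UnitAddTorus ι)} [IsFiniteMeasure a]
    [IsFiniteMeasure b] (hab : ∀ h, charCoeff a h = charCoeff b h) : a = b := by
  have key (f : C(UnitAddTorus ι, ℂ)) : ∫ x, f x ∂a = ∫ x, f x ∂b := by
    have hf : f ∈ (Submodule.span ℂ (Set.range (mFourier (d := ι)))).topologicalClosure := by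
      rw [span_mFourier_closure_eq_top]; trivial
    refine closure_minimal (t := {f : C(UnitAddTorus ι, ℂ) | ∫ x, f x ∂a = ∫ x, f x ∂b}) ?_
      (isClosed_eq (continuous_integral_continuousMap a) (continuous_integral_continuousMap b)) hf
    intro f hf
    induction hf using Submodule.span_induction with
    | mem f hf => obtain ⟨h, rfl⟩ := hf; exact hab h
    | zero => simp
    | add f g _ _ hf hg =>
      simp only [Set.mem_ofPred_eq, ContinuousMap.add_apply] at hf hg ⊢
      rw [integral_add (integrable_continuousMap _ _) (integrable_continuousMap _ _),
        integral_add (integrable_continuousMap _ _) (integrable_continuousMap _ _), hf, hg]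
    | smul c f _ hf =>
      simp only [Set.mem_ofPred_eq, ContinuousMap.smul_apply] at hf ⊢
      rw [integral_smul, integral_smul, hf]
  refine ext_of_forall_integral_eq_of_IsFiniteMeasure fun f => ?_
  have h := key ⟨fun x => (f x : ℂ), by fun_prop⟩
  simp only [ContinuousMap.coe_mk] at h
  rw [integral_complex_ofReal, integral_complex_ofReal] at h
  exact_mod_cast h

/-- **Parseval's identity** for finite combinations of orthonormal continuous functions. -/
lemma integral_norm_sq_sum {X I : Type*} [TopologicalSpace X] [CompactSpace X]
    [MeasurableSpace X] [BorelSpace X] (μ : Measure X) [IsFiniteMeasure μ] [DecidableEq I]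
    (e : I → C(X, ℂ)) (he : ∀ i j, ∫ x, e i x * conj (e j x) ∂μ = if i = j then 1 else 0)
    (S : Finset I) (c : I → ℂ) :
    ∫ x, ‖∑ i ∈ S, c i * e i x‖ ^ 2 ∂μ = ∑ i ∈ S, ‖c i‖ ^ 2 := by
  have hint (i j : I) : Integrable (fun x => c i * conj (c j) * (e i x * conj (e j x))) μ := by
    refine Continuous.integrable_of_hasCompactSupport (by fun_prop)
      (HasCompactSupport.of_compactSpace _)
  have e1 (x : X) : ((‖∑ i ∈ S, c i * e i x‖ ^ 2 : ℝ) : ℂ) =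
      ∑ i ∈ S, ∑ j ∈ S, c i * conj (c j) * (e i x * conj (e j x)) := by
    rw [Complex.ofReal_pow, ← Complex.mul_conj', map_sum, Finset.sum_mul_sum]
    refine Finset.sum_congr rfl fun i _ => Finset.sum_congr rfl fun j _ => ?_
    rw [map_mul]; ring
  have e2 : ((∫ x, ‖∑ i ∈ S, c i * e i x‖ ^ 2 ∂μ : ℝ) : ℂ) =
      ((∑ i ∈ S, ‖c i‖ ^ 2 : ℝ) : ℂ) := by
    rw [← integral_complex_ofReal]
    simp_rw [e1]
    rw [integral_finsetSum _ fun i _ => integrable_finsetSum _ fun j _ => hint i j]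
    push_cast
    refine Finset.sum_congr rfl fun i hi => ?_
    rw [integral_finsetSum _ fun j _ => hint i j]
    simp_rw [integral_const_mul, he]
    simp [hi, Complex.mul_conj']
  exact_mod_cast e2

lemma integral_mFourier_mul_conj [DecidableEq (ι → ℤ)] (h h' : ι → ℤ) :
    ∫ x : UnitAddTorus ι, mFourier h x * conj (mFourier h' x) = if h = h' then 1 else 0 := by
  have := charCoeff_volume (h - h')
  simp only [sub_eq_zero] at this
  rw [← this]
  unfold charCoeff
  simp_rw [← mFourier_neg, ← mFourier_add, ← sub_eq_add_neg]

lemma integral_le_sqrt_integral_sq {X : Type*} [MeasurableSpace X] (μ : Measure X)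
    [IsProbabilityMeasure μ] {f : X → ℝ} (hf : Integrable f μ)
    (hf2 : Integrable (fun x => f x ^ 2) μ) : ∫ x, f x ∂μ ≤ √(∫ x, f x ^ 2 ∂μ) := by
  refine Real.le_sqrt_of_sq_le ?_
  set A := ∫ x, f x ∂μ with hA
  have h0 : 0 ≤ ∫ x, (f x - A) ^ 2 ∂μ := integral_nonneg fun x => sq_nonneg _
  have e : ∫ x, (f x - A) ^ 2 ∂μ = ∫ x, f x ^ 2 ∂μ - A ^ 2 := by
    have : ∀ x, (f x - A) ^ 2 = f x ^ 2 - (2 * A * f x - A ^ 2) := fun x => by ring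
    simp_rw [this]
    have hi : Integrable (fun x => 2 * A * f x - A ^ 2) μ :=
      (hf.const_mul _).sub (integrable_const _)
    rw [integral_sub hf2 hi,
      integral_sub (hf.const_mul _) (integrable_const _), integral_const_mul, ← hA]
    simp; ring
  linarith

/-- A probability measure whose Fourier coefficients vanish outside a finite set differs from the
Haar measure by a signed measure with total variation at most the `ℓ²` norm of its nontrivial
Fourier coefficients. The signed measure is given by its positive part `p` and negative
part `m`. -/
lemma exists_add_eq_volume_add (ρ : Measure (UnitAddTorus ι)) [IsProbabilityMeasure ρ]
    (S : Finset (ι → ℤ)) (h0 : 0 ∉ S) (hS : ∀ h, h ≠ 0 → h ∉ S → charCoeff ρ h = 0) :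
    ∃ p m : Measure (UnitAddTorus ι), IsFiniteMeasure p ∧ IsFiniteMeasure m ∧
      ρ + m = volume + p ∧
      p Set.univ + m Set.univ ≤ ENNReal.ofReal √(∑ h ∈ S, ‖charCoeff ρ h‖ ^ 2) := by
  classical
  -- the density of `ρ - volume` is the real part of the trigonometric polynomial `g`
  set g : C(UnitAddTorus ι, ℂ) := ∑ h ∈ S, charCoeff ρ h • mFourier (-h) with hg
  have hgx (x) : g x = ∑ h ∈ S, charCoeff ρ h * mFourier (-h) x := by
    simp [hg, ContinuousMap.sum_apply]
  set u : UnitAddTorus ι → ℝ := fun x => (g x).re with hu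
  have huc : Continuous u := by fun_prop
  have hgi : Integrable (fun x => ‖g x‖) (volume : Measure (UnitAddTorus ι)) :=
    (integrable_continuousMap _ g).norm
  have hcont {f : UnitAddTorus ι → ℂ} (hf : Continuous f) : Integrable f :=
    integrable_continuousMap _ ⟨f, hf⟩
  have hfin {w : UnitAddTorus ι → ℝ} (hw : Continuous w) :
      IsFiniteMeasure (volume.withDensity fun x => ENNReal.ofReal (w x)) := by
    refine isFiniteMeasure_withDensity_ofReal ?_
    exact (Continuous.integrable_of_hasCompactSupport hw
      (HasCompactSupport.of_compactSpace _)).hasFiniteIntegral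
  have hp := hfin huc
  have hm := hfin huc.neg
  have hcoef {w : UnitAddTorus ι → ℝ} (hw : Continuous w) (h : ι → ℤ) :
      charCoeff (volume.withDensity fun x => ENNReal.ofReal (w x)) h =
        ∫ x, (max (w x) 0 : ℝ) * mFourier h x := by
    unfold charCoeff
    rw [integral_withDensity_eq_integral_toReal_smul (by fun_prop) (by simp)]
    refine integral_congr_ae (Filter.Eventually.of_forall fun x => ?_)
    simp [ENNReal.toReal_ofReal']
  refine ⟨_, _, hp, hm, measure_ext_charCoeff fun h => ?_, ?_⟩
  · rw [charCoeff_add, charCoeff_add, charCoeff_volume, hcoef huc, hcoef huc.neg]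
    have e1 : (∫ x, ((max (u x) 0 : ℝ) : ℂ) * mFourier h x) -
        ∫ x, ((max (-u x) 0 : ℝ) : ℂ) * mFourier h x = if h = 0 then 0 else charCoeff ρ h := by
      have ha (h) (hh : h ∈ S) : Integrable fun x =>
          charCoeff ρ h * (mFourier (-h) x : ℂ) := hcont (by fun_prop)
      have e2 : ∫ x, g x * mFourier h x = if h ∈ S then charCoeff ρ h else 0 := by
        simp_rw [hgx, Finset.sum_mul]
        rw [integral_finsetSum _ fun h' _ => hcont (by fun_prop)]
        simp_rw [mul_assoc, integral_const_mul, mFourier_neg, mul_comm (conj _),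
          integral_mFourier_mul_conj]
        simp
      have e3 : ∫ x, conj (g x) * mFourier h x = if -h ∈ S then charCoeff ρ h else 0 := by
        simp_rw [hgx, map_sum, Finset.sum_mul]
        rw [integral_finsetSum _ fun h' _ => hcont (by fun_prop)]
        have (h') (x : UnitAddTorus ι) : conj (charCoeff ρ h' * mFourier (-h') x) * mFourier h x
            = conj (charCoeff ρ h') * (mFourier h' x * conj (mFourier (-h) x)) := by
          rw [map_mul, ← mFourier_neg, ← mFourier_neg, neg_neg, neg_neg]; ring
        simp_rw [this, integral_const_mul, integral_mFourier_mul_conj]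
        simp [charCoeff_neg]
      rw [← integral_sub (hcont (by fun_prop)) (hcont (by fun_prop))]
      have e4 : ∀ x, ((max (u x) 0 : ℝ) : ℂ) * mFourier h x -
          ((max (-u x) 0 : ℝ) : ℂ) * mFourier h x =
            (1 / 2 : ℂ) * (g x * mFourier h x + conj (g x) * mFourier h x) := by
        intro x
        rw [← sub_mul, ← add_mul, Complex.add_conj, ← Complex.ofReal_sub]
        have : max (u x) 0 - max (-u x) 0 = u x := by
          rcases le_total 0 (u x) with h | h <;> simp [h]
        rw [this]; push_cast; ring
      simp_rw [e4]
      rw [integral_const_mul, integral_add (hcont (by fun_prop)) (hcont (by fun_prop)), e2, e3]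
      by_cases hh : h = 0
      · simp [hh, h0]
      · have i1 : (if h ∈ S then charCoeff ρ h else 0) = charCoeff ρ h := by
          split_ifs with h1
          · rfl
          · exact (hS h hh h1).symm
        have i2 : (if -h ∈ S then charCoeff ρ h else 0) = charCoeff ρ h := by
          split_ifs with h1
          · rfl
          · have := hS (-h) (by simpa using hh) h1
            rw [charCoeff_neg, map_eq_zero] at this
            exact this.symm
        rw [i1, i2, if_neg hh]; ring
    have e5 : charCoeff ρ h = (if h = 0 then 1 else 0) + (if h = 0 then 0 else charCoeff ρ h) := by
      split_ifs with hh
      · simp [hh, charCoeff_zero]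
      · simp
    rw [e5, ← e1]; simp only [Pi.neg_apply]; ring
  · rw [withDensity_apply _ MeasurableSet.univ, withDensity_apply _ MeasurableSet.univ,
      Measure.restrict_univ, ← lintegral_add_left (by fun_prop)]
    have hg2 : ∫ x, ‖g x‖ ^ 2 = ∑ h ∈ S, ‖charCoeff ρ h‖ ^ 2 := by
      simp_rw [hgx]
      refine integral_norm_sq_sum volume (fun h => mFourier (-h)) (fun h h' => ?_) S (charCoeff ρ)
      rw [integral_mFourier_mul_conj]; simp
    calc _ ≤ ∫⁻ x, ENNReal.ofReal ‖g x‖ := by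
          refine lintegral_mono fun x => ?_
          have := Complex.abs_re_le_norm (g x)
          rcases le_total 0 (u x) with h | h
          · simp only [Pi.neg_apply]
            rw [ENNReal.ofReal_of_nonpos (neg_nonpos.mpr h), add_zero]
            exact ENNReal.ofReal_le_ofReal ((le_abs_self _).trans this)
          · simp only [Pi.neg_apply]
            rw [ENNReal.ofReal_of_nonpos h, zero_add]
            exact ENNReal.ofReal_le_ofReal ((neg_le_abs _).trans this)
      _ = ENNReal.ofReal (∫ x, ‖g x‖) :=
          (ofReal_integral_eq_lintegral_ofReal hgi
            (Filter.Eventually.of_forall fun x => norm_nonneg _)).symm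
      _ ≤ _ := by
          refine ENNReal.ofReal_le_ofReal ?_
          rw [← hg2]
          refine integral_le_sqrt_integral_sq _ hgi ?_
          exact Continuous.integrable_of_hasCompactSupport (by fun_prop)
            (HasCompactSupport.of_compactSpace _)

end Fourier

/-! ### Smoothing kernels -/

section Kernel

/-- Every point of the circle has a representative of the same absolute value. -/
lemma exists_coe_eq_abs_eq (x : UnitAddCircle) :
    ∃ s : ℝ, (s : UnitAddCircle) = x ∧ |s| = ‖x‖ := by
  induction x using QuotientAddGroup.induction_on with
  | H t =>
    refine ⟨t - round t, ?_, UnitAddCircle.norm_eq.symm⟩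
    have : ((round t : ℝ) : UnitAddCircle) = 0 :=
      AddCircle.coe_eq_zero_iff 1 |>.mpr ⟨round t, by simp⟩
    rw [AddCircle.coe_sub, this, sub_zero]

lemma norm_circle_le_half (x : UnitAddCircle) : ‖x‖ ≤ 1 / 2 := by
  simpa using AddCircle.norm_le_half_period (1 : ℝ) one_ne_zero (x := x)

lemma four_mul_norm_le_norm_fourier_sub_one (x : UnitAddCircle) :
    4 * ‖x‖ ≤ ‖fourier 1 x - 1‖ := by
  obtain ⟨s, rfl, hs⟩ := exists_coe_eq_abs_eq x
  have hs2 := norm_circle_le_half s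
  rw [← hs] at hs2 ⊢
  have e2 : fourier 1 (s : UnitAddCircle) =
      Complex.exp (Complex.I * (2 * Real.pi * s : ℝ)) := by
    rw [fourier_coe_apply]
    congr 1; push_cast; ring
  have e3 : |2 * Real.pi * s / 2| = Real.pi * |s| := by
    rw [mul_assoc, mul_div_cancel_left₀ _ two_ne_zero, abs_mul, abs_of_pos Real.pi_pos]
  rw [e2, Complex.norm_exp_I_mul_ofReal_sub_one]
  have h := Real.mul_abs_le_abs_sin (x := 2 * Real.pi * s / 2) (by
    rw [e3]; nlinarith [Real.pi_pos])
  rw [norm_mul, Real.norm_eq_abs, Real.norm_eq_abs, abs_two]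
  have e4 : 2 / Real.pi * |2 * Real.pi * s / 2| = 2 * |s| := by
    rw [e3]; field_simp
  linarith

/-- The tent function `max 0 (N - |n|)`. -/
def tent (N : ℕ) (n : ℤ) : ℝ := max 0 (N - |(n : ℝ)|)

lemma tent_eq_zero {N : ℕ} {n : ℤ} (h : n ∉ Finset.Ioo (-N : ℤ) N) : tent N n = 0 := by
  have h1 : (N : ℤ) ≤ |n| := by
    rw [Finset.mem_Ioo] at h
    by_contra! h2
    exact h (abs_lt.mp h2)
  have h2 : (N : ℝ) ≤ |(n : ℝ)| := by exact_mod_cast h1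
  simpa [tent] using h2

lemma abs_tent_sub_le (N : ℕ) (n : ℤ) : |tent N (n - 1) - tent N n| ≤ 1 := by
  unfold tent
  refine (abs_max_sub_max_le_max _ _ _ _).trans ?_
  have := abs_abs_sub_abs_le_abs_sub (n : ℝ) ((n - 1 : ℤ) : ℝ)
  push_cast at this ⊢
  simp only [sub_self, abs_zero, zero_le_one, max_le_iff, true_and]
  rw [show (N : ℝ) - |(n : ℝ) - 1| - (N - |(n : ℝ)|) = |(n : ℝ)| - |(n : ℝ) - 1| by ring]
  exact this.trans (by norm_num)

/-- The trigonometric polynomial with the tent function as coefficients. -/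
def tentPoly (N : ℕ) (x : UnitAddCircle) : ℂ :=
  ∑ n ∈ Finset.Ioo (-N : ℤ) N, (tent N n : ℂ) * fourier n x

/-- The squared `L²` norm of `tentPoly N`. -/
def tentMass (N : ℕ) : ℝ := ∑ n ∈ Finset.Ioo (-N : ℤ) N, tent N n ^ 2

lemma tentMass_ge (N : ℕ) (hN : 1 ≤ N) : (N : ℝ) ^ 3 / 4 ≤ tentMass N := by
  set S := Finset.Icc (-(N / 2 : ℕ) : ℤ) (N / 2 : ℕ) with hS
  have hsub : S ⊆ Finset.Ioo (-N : ℤ) N := by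
    intro n hn
    rw [hS, Finset.mem_Icc] at hn
    rw [Finset.mem_Ioo]; omega
  have hcard : (N : ℝ) ≤ S.card := by
    rw [hS, Int.card_Icc]
    exact_mod_cast (by omega)
  calc (N : ℝ) ^ 3 / 4 = N * (N / 2 : ℝ) ^ 2 := by ring
    _ ≤ S.card * (N / 2 : ℝ) ^ 2 := by gcongr
    _ = ∑ _n ∈ S, (N / 2 : ℝ) ^ 2 := by simp
    _ ≤ ∑ n ∈ S, tent N n ^ 2 := by
        refine Finset.sum_le_sum fun n hn => ?_
        have h1 : 2 * |n| ≤ N := by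
          rw [hS, Finset.mem_Icc] at hn
          have : |n| ≤ (N / 2 : ℕ) := abs_le.mpr hn
          omega
        have h2 : 2 * |(n : ℝ)| ≤ N := by exact_mod_cast h1
        gcongr
        exact le_max_of_le_right (by linarith)
    _ ≤ tentMass N :=
        Finset.sum_le_sum_of_subset_of_nonneg hsub fun _ _ _ => sq_nonneg _

lemma tentMass_pos (N : ℕ) (hN : 1 ≤ N) : 0 < tentMass N :=
  lt_of_lt_of_le (by positivity) (tentMass_ge N hN)

lemma continuous_tentPoly (N : ℕ) : Continuous (tentPoly N) := by
  unfold tentPoly; fun_prop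

lemma integral_fourier_mul_conj (m n : ℤ) :
    ∫ x : UnitAddCircle, fourier m x * conj (fourier n x) = if m = n then 1 else 0 := by
  have := integral_fourier_volume (m - n)
  simp only [sub_eq_zero] at this
  rw [← this]
  simp_rw [← fourier_neg, ← fourier_add, ← sub_eq_add_neg]

lemma integral_norm_tentPoly_sq (N : ℕ) :
    ∫ x : UnitAddCircle, ‖tentPoly N x‖ ^ 2 = tentMass N := by
  unfold tentPoly tentMass
  rw [integral_norm_sq_sum volume fourier integral_fourier_mul_conj]
  simp

lemma fourier_sub_one_mul_tentPoly (N : ℕ) (x : UnitAddCircle) :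
    (fourier 1 x - 1) * tentPoly N x =
      ∑ n ∈ Finset.Icc (-N : ℤ) N, ((tent N (n - 1) - tent N n : ℝ) : ℂ) * fourier n x := by
  have e1 : tentPoly N x = ∑ n ∈ Finset.Icc (-N : ℤ) N, (tent N n : ℂ) * fourier n x :=
    Finset.sum_subset Finset.Ioo_subset_Icc_self fun n _ hn => by simp [tent_eq_zero hn]
  have e2 : fourier 1 x * tentPoly N x =
      ∑ n ∈ Finset.Icc (-N : ℤ) N, (tent N (n - 1) : ℂ) * fourier n x := by
    rw [tentPoly, Finset.mul_sum]
    refine Finset.sum_subset_zero_on_sdiff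
      (s₁ := (Finset.Ioo (-N : ℤ) N).map (addRightEmbedding 1)) (g := fun n : ℤ =>
        (tent N (n - 1) : ℂ) * fourier n x) (f := fun n : ℤ =>
        (tent N (n - 1) : ℂ) * fourier n x) ?_ ?_ (fun _ _ => rfl) |>.symm ▸ ?_
    · intro n hn
      simp only [Finset.mem_map, Finset.mem_Ioo, addRightEmbedding_apply] at hn
      obtain ⟨m, hm, rfl⟩ := hn
      rw [Finset.mem_Icc]; omega
    · intro n hn
      have : n - 1 ∉ Finset.Ioo (-N : ℤ) N := by
        intro h
        apply (Finset.mem_sdiff.mp hn).2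
        exact Finset.mem_map.mpr ⟨n - 1, h, by simp⟩
      simp [tent_eq_zero this]
    · rw [Finset.sum_map]
      refine Finset.sum_congr rfl fun n _ => ?_
      simp only [addRightEmbedding_apply, add_sub_cancel_right, fourier_add]
      ring
  rw [sub_mul, one_mul, e2, e1, ← Finset.sum_sub_distrib]
  refine Finset.sum_congr rfl fun n _ => ?_
  push_cast; ring

/-- A Jackson-type kernel: the probability measure on the circle with density proportional to
`|tentPoly N|²`. It has frequencies below `2 * N` and is concentrated at scale `1 / N`. -/
def circleKernel (N : ℕ) : Measure UnitAddCircle :=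
  volume.withDensity fun x => ENNReal.ofReal (‖tentPoly N x‖ ^ 2 / tentMass N)

lemma continuous_circleKernel_density (N : ℕ) :
    Continuous fun x => ‖tentPoly N x‖ ^ 2 / tentMass N := by
  have := continuous_tentPoly N
  fun_prop

lemma isProbabilityMeasure_circleKernel (N : ℕ) (hN : 1 ≤ N) :
    IsProbabilityMeasure (circleKernel N) := by
  constructor
  have hc := continuous_circleKernel_density N
  have hp := tentMass_pos N hN
  rw [circleKernel, withDensity_apply _ MeasurableSet.univ, Measure.restrict_univ,
    ← ofReal_integral_eq_lintegral_ofReal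
      (hc.integrable_of_hasCompactSupport (HasCompactSupport.of_compactSpace _))
      (Filter.Eventually.of_forall fun x => by positivity), integral_div,
    integral_norm_tentPoly_sq, div_self hp.ne', ENNReal.ofReal_one]

lemma integral_circleKernel {E : Type*} [NormedAddCommGroup E] [NormedSpace ℝ E] (N : ℕ)
    (hN : 1 ≤ N) (f : UnitAddCircle → E) :
    ∫ x, f x ∂circleKernel N = ∫ x, (‖tentPoly N x‖ ^ 2 / tentMass N) • f x := by
  have hc := continuous_circleKernel_density N
  have hp := tentMass_pos N hN
  rw [circleKernel,
    integral_withDensity_eq_integral_toReal_smul hc.measurable.ennreal_ofReal (by simp)]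
  refine integral_congr_ae (Filter.Eventually.of_forall fun x => ?_)
  simp only
  rw [ENNReal.toReal_ofReal (by positivity)]

lemma integral_fourier_circleKernel (N : ℕ) (hN : 1 ≤ N) (h : ℤ) (hh : 2 * (N : ℤ) ≤ |h| + 1) :
    ∫ x, fourier h x ∂circleKernel N = 0 := by
  have hint (n m : ℤ) : Integrable fun x : UnitAddCircle =>
      (tent N n * tent N m / tentMass N : ℂ) * (fourier (h + n) x * conj (fourier m x)) :=
    Continuous.integrable_of_hasCompactSupport (by fun_prop)
      (HasCompactSupport.of_compactSpace _)
  have e (x : UnitAddCircle) : (‖tentPoly N x‖ ^ 2 / tentMass N) • fourier h x =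
      ∑ n ∈ Finset.Ioo (-N : ℤ) N, ∑ m ∈ Finset.Ioo (-N : ℤ) N,
        (tent N n * tent N m / tentMass N : ℂ) * (fourier (h + n) x * conj (fourier m x)) := by
    rw [Complex.real_smul, Complex.ofReal_div, Complex.ofReal_pow, ← Complex.mul_conj', tentPoly,
      map_sum, Finset.sum_mul_sum, Finset.sum_div, Finset.sum_mul]
    refine Finset.sum_congr rfl fun n _ => ?_
    rw [Finset.sum_div, Finset.sum_mul]
    refine Finset.sum_congr rfl fun m _ => ?_
    rw [map_mul, Complex.conj_ofReal, fourier_add]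
    ring
  rw [integral_circleKernel N hN]
  simp_rw [e]
  rw [integral_finsetSum _ fun n _ => integrable_finsetSum _ fun m _ => hint n m]
  refine Finset.sum_eq_zero fun n hn => ?_
  rw [integral_finsetSum _ fun m _ => hint n m]
  refine Finset.sum_eq_zero fun m hm => ?_
  rw [integral_const_mul, integral_fourier_mul_conj, if_neg, mul_zero]
  rw [Finset.mem_Ioo] at hn hm
  rcases abs_cases h with ⟨h1, h2⟩ | ⟨h1, h2⟩ <;> omega

lemma lintegral_enorm_circleKernel_le (N : ℕ) (hN : 1 ≤ N) :
    ∫⁻ x, ‖x‖ₑ ∂circleKernel N ≤ ENNReal.ofReal (1 / N) := by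
  have := isProbabilityMeasure_circleKernel N hN
  have hp := tentMass_pos N hN
  have hN' : (0 : ℝ) < N := by exact_mod_cast hN
  have hcp := continuous_tentPoly N
  have hint {f : UnitAddCircle → ℝ} (hf : Continuous f) (μ : Measure UnitAddCircle)
      [IsFiniteMeasure μ] : Integrable f μ :=
    hf.integrable_of_hasCompactSupport (HasCompactSupport.of_compactSpace _)
  have h2 : ∫ x, ‖x‖ ^ 2 ∂circleKernel N ≤ (1 / N : ℝ) ^ 2 := by
    rw [integral_circleKernel N hN]
    calc _ ≤ ∫ x : UnitAddCircle, ‖(fourier 1 x - 1) * tentPoly N x‖ ^ 2 / (16 * tentMass N) := by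
          refine integral_mono (hint (by fun_prop) _) (hint (by fun_prop) _) fun x => ?_
          have h4 := four_mul_norm_le_norm_fourier_sub_one x
          have h5 : (4 * ‖x‖) ^ 2 ≤ ‖fourier 1 x - 1‖ ^ 2 := by gcongr
          simp only [smul_eq_mul]
          rw [norm_mul, mul_pow, div_mul_eq_mul_div, div_le_div_iff₀ hp (by positivity)]
          have : 0 ≤ ‖tentPoly N x‖ ^ 2 * tentMass N := by positivity
          nlinarith
      _ = (∑ n ∈ Finset.Icc (-N : ℤ) N, (tent N (n - 1) - tent N n) ^ 2) / (16 * tentMass N) := by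
          rw [integral_div]
          simp_rw [fourier_sub_one_mul_tentPoly]
          rw [integral_norm_sq_sum volume fourier integral_fourier_mul_conj]
          simp_rw [Complex.norm_real, Real.norm_eq_abs, sq_abs]
      _ ≤ (∑ n ∈ Finset.Icc (-N : ℤ) N, 1) / (16 * (N ^ 3 / 4)) := by
          gcongr with n _
          · rw [← sq_abs]
            exact pow_le_one₀ (abs_nonneg _) (abs_tent_sub_le N n)
          · exact tentMass_ge N hN
      _ = (2 * N + 1) / (4 * N ^ 3) := by
          have : (N + 1 + N : ℤ).toNat = 2 * N + 1 := by omega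
          rw [Finset.sum_const, Int.card_Icc]
          simp only [sub_neg_eq_add, this, nsmul_eq_mul, mul_one]
          push_cast; ring
      _ ≤ (1 / N : ℝ) ^ 2 := by
          have : (1 : ℝ) ≤ N := by exact_mod_cast hN
          rw [div_pow, one_pow, div_le_div_iff₀ (by positivity) (by positivity)]
          nlinarith [sq_nonneg (N : ℝ), mul_nonneg hN'.le (sq_nonneg (N : ℝ))]
  have h1 : ∫ x, ‖x‖ ∂circleKernel N ≤ 1 / N := by
    refine (integral_le_sqrt_integral_sq _ (hint (by fun_prop) _) (hint (by fun_prop) _)).trans ?_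
    exact (Real.sqrt_le_sqrt h2).trans_eq (Real.sqrt_sq (by positivity))
  calc _ = ENNReal.ofReal (∫ x, ‖x‖ ∂circleKernel N) := by
        rw [ofReal_integral_eq_lintegral_ofReal (hint (by fun_prop) _)
          (Filter.Eventually.of_forall fun x => norm_nonneg _)]
        simp_rw [ofReal_norm]
    _ ≤ _ := ENNReal.ofReal_le_ofReal h1

variable {ι : Type*} [Fintype ι]

/-- The product of the kernels `circleKernel N` over all coordinates of the torus. -/
def torusKernel (N : ℕ) : Measure (UnitAddTorus ι) := Measure.pi fun _ => circleKernel N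

lemma isProbabilityMeasure_torusKernel (N : ℕ) (hN : 1 ≤ N) :
    IsProbabilityMeasure (torusKernel N : Measure (UnitAddTorus ι)) := by
  have := isProbabilityMeasure_circleKernel N hN
  unfold torusKernel; infer_instance

lemma charCoeff_torusKernel (N : ℕ) (hN : 1 ≤ N) (h : ι → ℤ) (i : ι)
    (hi : 2 * (N : ℤ) ≤ |h i| + 1) : charCoeff (torusKernel N) h = 0 := by
  have := isProbabilityMeasure_circleKernel N hN
  have e : charCoeff (torusKernel N) h = ∏ i, ∫ x : UnitAddCircle, fourier (h i) x ∂circleKernel N :=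
    integral_fintype_prod_eq_prod (μ := fun _ => circleKernel N)
      (fun i (x : UnitAddCircle) => (fourier (h i) x : ℂ))
  rw [e]
  exact Finset.prod_eq_zero (Finset.mem_univ i) (integral_fourier_circleKernel N hN _ hi)

lemma displacement_torusKernel_le (N : ℕ) (hN : 1 ≤ N) :
    displacement (torusKernel N : Measure (UnitAddTorus ι)) ≤
      Fintype.card ι * ENNReal.ofReal (1 / N) := by
  have := isProbabilityMeasure_circleKernel N hN
  calc _ ≤ ∫⁻ x : UnitAddTorus ι, ∑ i, ‖x i‖ₑ ∂torusKernel N := by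
        refine lintegral_mono fun x => ?_
        simp only [enorm, Pi.nnnorm_def]
        exact_mod_cast Finset.sup_le fun i _ =>
          Finset.single_le_sum (f := fun i => ‖x i‖₊) (fun _ _ => zero_le) (Finset.mem_univ i)
    _ = ∑ _i : ι, ∫⁻ x, ‖x‖ₑ ∂circleKernel N := by
        rw [lintegral_finsetSum _ fun i _ => by fun_prop]
        refine Finset.sum_congr rfl fun i _ => ?_
        exact (measurePreserving_eval (fun _ : ι => circleKernel N) i).lintegral_comp
          (f := fun x => ‖x‖ₑ) (by fun_prop)
    _ ≤ ∑ _i : ι, ENNReal.ofReal (1 / N) :=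
        Finset.sum_le_sum fun i _ => lintegral_enorm_circleKernel_le N hN
    _ = _ := by simp

end Kernel

/-! ### The smoothing inequality -/

section Smoothing

variable {ι : Type*} [Fintype ι]

open Classical in
/-- The nonzero frequencies with all coordinates less than `H` in absolute value. -/
def freqBox (ι : Type*) [Fintype ι] (H : ℕ) : Finset (ι → ℤ) :=
  (Fintype.piFinset fun _ => Finset.Ioo (-H : ℤ) H).erase 0

lemma mem_freqBox {H : ℕ} {h : ι → ℤ} : h ∈ freqBox ι H ↔ h ≠ 0 ∧ ∀ i, |h i| < H := by
  simp [freqBox, abs_lt]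

instance : IsProbabilityMeasure (volume : Measure (UnitAddTorus ι)) :=
  inferInstanceAs (IsProbabilityMeasure (Measure.pi fun _ : ι => (volume : Measure UnitAddCircle)))

lemma edist_torus_le_one (x y : UnitAddTorus ι) : edist x y ≤ 1 := by
  rw [edist_dist]
  refine ENNReal.ofReal_le_one.mpr ((dist_pi_le_iff zero_le_one).mpr fun i => ?_)
  rw [dist_eq_norm]
  linarith [norm_circle_le_half (x i - y i)]

lemma volume_conv (κ : Measure (UnitAddTorus ι)) [IsProbabilityMeasure κ] :
    (volume : Measure (UnitAddTorus ι)).conv κ = volume := by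
  refine measure_ext_charCoeff fun h => ?_
  rw [charCoeff_conv, charCoeff_volume]
  split_ifs with h0
  · simp [h0, charCoeff_zero]
  · simp

/-- Successive smoothing of a measure by kernels at the dyadic scales `2⁻ᴶ, 2¹⁻ᴶ, …, 1`. -/
def smoothed (ρ : Measure (UnitAddTorus ι)) (J : ℕ) : ℕ → Measure (UnitAddTorus ι)
  | 0 => ρ
  | j + 1 => (smoothed ρ J j).conv (torusKernel (2 ^ (J - j)))

variable (ρ : Measure (UnitAddTorus ι)) [IsProbabilityMeasure ρ] (J : ℕ)

instance (j : ℕ) : IsProbabilityMeasure (torusKernel (2 ^ j) : Measure (UnitAddTorus ι)) :=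
  isProbabilityMeasure_torusKernel _ Nat.one_le_two_pow

instance isProbabilityMeasure_smoothed (j : ℕ) : IsProbabilityMeasure (smoothed ρ J j) := by
  induction j with
  | zero => simpa [smoothed]
  | succ j ih => rw [smoothed]; infer_instance

lemma norm_charCoeff_smoothed_le (j : ℕ) (h : ι → ℤ) :
    ‖charCoeff (smoothed ρ J j) h‖ ≤ ‖charCoeff ρ h‖ := by
  induction j with
  | zero => rfl
  | succ j ih =>
    rw [smoothed, charCoeff_conv, norm_mul]
    exact (mul_le_of_le_one_right (norm_nonneg _) (norm_charCoeff_le_one _ _)).trans ih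

lemma charCoeff_smoothed_succ (j : ℕ) (h : ι → ℤ) (i : ι)
    (hi : 2 * (2 ^ (J - j) : ℕ) ≤ |h i| + 1) : charCoeff (smoothed ρ J (j + 1)) h = 0 := by
  rw [smoothed, charCoeff_conv, charCoeff_torusKernel _ Nat.one_le_two_pow h i hi, mul_zero]

/-- The last kernel is the Haar measure, so the smoothing ends there. -/
lemma smoothed_last : smoothed ρ J (J + 1) = volume := by
  refine measure_ext_charCoeff fun h => ?_
  rw [charCoeff_volume]
  split_ifs with h0
  · rw [h0, charCoeff_zero]
  · obtain ⟨i, hi⟩ := Function.ne_iff.mp h0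
    refine charCoeff_smoothed_succ ρ J J h i ?_
    have : 1 ≤ |h i| := Int.one_le_abs hi
    simp; omega

lemma transportCost_smoothed_succ_le (j : ℕ) :
    transportCost (smoothed ρ J (j + 1)) (smoothed ρ J (j + 2)) ≤
      Fintype.card ι * ENNReal.ofReal (1 / 2 ^ (J - (j + 1)) *
        √(∑ h ∈ freqBox ι (2 * 2 ^ (J - j)), ‖charCoeff ρ h‖ ^ 2)) := by
  obtain ⟨p, m, hp, hm, e, hpm⟩ := exists_add_eq_volume_add (smoothed ρ J (j + 1))
    (freqBox ι (2 * 2 ^ (J - j))) (by simp [mem_freqBox]) (fun h h0 hh => by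
      rw [mem_freqBox] at hh
      push Not at hh
      obtain ⟨i, hi⟩ := hh h0
      exact charCoeff_smoothed_succ ρ J j h i (by push_cast at hi ⊢; omega))
  rw [smoothed]
  refine (transportCost_conv_le_of_add_eq _ volume _ p m ENNReal.one_ne_top edist_torus_le_one
    (volume_conv _) e).trans ?_
  rw [ENNReal.ofReal_mul (by positivity), ← mul_assoc]
  gcongr
  · exact_mod_cast displacement_torusKernel_le (ι := ι) (2 ^ (J - (j + 1))) Nat.one_le_two_pow
  · refine hpm.trans (ENNReal.ofReal_le_ofReal (Real.sqrt_le_sqrt ?_))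
    gcongr with h _
    exact norm_charCoeff_smoothed_le ρ J (j + 1) h

/-- **Smoothing inequality**: the transport cost from a probability measure on the torus to the
Haar measure is controlled by the smallest scale and by the Fourier coefficients at each
larger scale. -/
theorem transportCost_volume_le :
    transportCost ρ volume ≤ ENNReal.ofReal (Fintype.card ι * (1 / 2 ^ J +
      ∑ j ∈ Finset.range J, 1 / 2 ^ (J - (j + 1)) *
        √(∑ h ∈ freqBox ι (2 * 2 ^ (J - j)), ‖charCoeff ρ h‖ ^ 2))) := by
  have chain (n : ℕ) : transportCost (smoothed ρ J 0) (smoothed ρ J n) ≤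
      ∑ j ∈ Finset.range n, transportCost (smoothed ρ J j) (smoothed ρ J (j + 1)) := by
    induction n with
    | zero => simp [transportCost_self]
    | succ n ih =>
      rw [Finset.sum_range_succ]
      exact (transportCost_triangle _ (smoothed ρ J n) _).trans (by gcongr)
  have h := chain (J + 1)
  rw [smoothed_last, Finset.sum_range_succ'] at h
  refine h.trans ?_
  rw [ENNReal.ofReal_mul (by positivity), ENNReal.ofReal_natCast,
    ENNReal.ofReal_add (by positivity) (Finset.sum_nonneg fun _ _ => by positivity),
    ENNReal.ofReal_sum_of_nonneg (fun _ _ => by positivity), mul_add, Finset.mul_sum, add_comm]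
  gcongr with j _
  · rw [smoothed]
    refine (transportCost_conv_le _ _).trans ?_
    rw [measure_univ, mul_one]
    exact_mod_cast displacement_torusKernel_le (ι := ι) (2 ^ (J - 0)) Nat.one_le_two_pow
  · exact transportCost_smoothed_succ_le ρ J j

end Smoothing

/-! ### Comparison with the Wasserstein distance -/

section Euclidean

variable {d : ℕ}

lemma euclDist_nonneg (x y : UnitAddTorus (Fin d)) : 0 ≤ euclDist x y := Real.sqrt_nonneg _

lemma euclDist_le (x y : UnitAddTorus (Fin d)) : euclDist x y ≤ √d * dist x y := by
  rw [euclDist, ← Real.sqrt_sq (dist_nonneg (x := x) (y := y)), ← Real.sqrt_mul (Nat.cast_nonneg d)]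
  refine Real.sqrt_le_sqrt ?_
  calc ∑ j, ‖x j - y j‖ ^ 2 ≤ ∑ _j : Fin d, dist x y ^ 2 := by
        gcongr with j _
        rw [← dist_eq_norm]
        exact dist_le_pi_dist x y j
    _ = _ := by simp

lemma W1_le_of_transportCost_le {a b : Measure (UnitAddTorus (Fin d))} [IsProbabilityMeasure a]
    {B : ℝ} (hB : 0 ≤ B) (h : transportCost a b ≤ ENNReal.ofReal B) : W1 a b ≤ √d * B := by
  have hbdd : BddBelow ((fun θ => ∫ z, euclDist z.1 z.2 ∂θ) '' couplings a b) :=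
    ⟨0, by rintro _ ⟨θ, _, rfl⟩; exact integral_nonneg fun z => euclDist_nonneg _ _⟩
  have key (ε : ℝ) (hε : 0 < ε) : W1 a b ≤ √d * (B + ε) := by
    have hlt : transportCost a b < ENNReal.ofReal (B + ε) :=
      h.trans_lt ((ENNReal.ofReal_lt_ofReal_iff (by positivity)).mpr (by linarith))
    obtain ⟨⟨θ, h1, h2⟩, hθ⟩ := iInf_lt_iff.mp hlt
    simp only at hθ
    have hprob : IsProbabilityMeasure θ := ⟨by rw [← Measure.fst_univ, h1, measure_univ]⟩
    refine (csInf_le hbdd ⟨θ, ⟨hprob, h1, h2⟩, rfl⟩).trans ?_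
    have hint : Integrable (fun z : UnitAddTorus (Fin d) × UnitAddTorus (Fin d) =>
        dist z.1 z.2) θ :=
      Continuous.integrable_of_hasCompactSupport (by fun_prop)
        (HasCompactSupport.of_compactSpace _)
    calc ∫ z, euclDist z.1 z.2 ∂θ ≤ ∫ z, √d * dist z.1 z.2 ∂θ :=
          integral_mono_of_nonneg (Filter.Eventually.of_forall fun z => euclDist_nonneg _ _)
            (hint.const_mul _) (Filter.Eventually.of_forall fun z => euclDist_le _ _)
      _ = √d * ∫ z, dist z.1 z.2 ∂θ := integral_const_mul _ _
      _ ≤ √d * (B + ε) := by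
          gcongr
          rw [integral_eq_lintegral_of_nonneg_ae
            (Filter.Eventually.of_forall fun z => dist_nonneg) hint.aestronglyMeasurable]
          refine ENNReal.toReal_le_of_le_ofReal (by positivity) ?_
          simp_rw [← edist_dist]
          exact hθ.le
  refine le_of_forall_pos_le_add fun ε hε => ?_
  have h1 := key (ε / (√d + 1)) (by positivity)
  have h2 : √d * (ε / (√d + 1)) ≤ ε := by
    rw [mul_div_assoc', div_le_iff₀ (by positivity)]
    nlinarith [Real.sqrt_nonneg (d : ℝ)]
  linarith

end Euclidean

/-! ### Fourier coefficients of the walk -/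

section CharacteristicFunction

/-- The characteristic function of an integer-valued distribution. -/
def charInt (p : Measure ℤ) (t : UnitAddCircle) : ℂ := ∫ z, fourier z t ∂p

lemma norm_fourier_apply (z : ℤ) (t : UnitAddCircle) : ‖(fourier z t : ℂ)‖ = 1 := by
  rw [fourier_apply, Circle.norm_coe]

lemma norm_fourier_add_le (n m : ℤ) (t : UnitAddCircle) :
    ‖(fourier n t : ℂ) + fourier m t‖ ≤ 2 - 4 * ‖(n - m) • t‖ ^ 2 := by
  set s := (n - m) • t with hs
  have e : (fourier n t : ℂ) + fourier m t = fourier m t * (fourier 1 s + 1) := by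
    have h1 : (fourier 1 s : ℂ) = fourier (n - m) t := by
      rw [fourier_apply, fourier_apply, one_zsmul]
    rw [h1, mul_add, ← fourier_add, mul_one]
    congr 2; ring_nf
  have h1 := four_mul_norm_le_norm_fourier_sub_one s
  have h2 := parallelogram_law_with_norm ℝ (fourier 1 s : ℂ) 1
  rw [norm_fourier_apply, norm_one] at h2
  have h3 : (4 * ‖s‖) ^ 2 ≤ ‖(fourier 1 s : ℂ) - 1‖ ^ 2 := by gcongr
  have h4 := norm_circle_le_half s
  have h5 : ‖s‖ ^ 2 ≤ 1 / 4 := by nlinarith [norm_nonneg s]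
  rw [e, norm_mul, norm_fourier_apply, one_mul]
  refine abs_le_of_sq_le_sq' ?_ (by linarith) |>.2
  nlinarith [sq_nonneg (‖s‖ ^ 2)]

/-- The characteristic function of a nondegenerate distribution on the integers is bounded away
from `1` off the lattice dual to the difference of two atoms. -/
lemma exists_norm_charInt_le (p : Measure ℤ) [IsProbabilityMeasure p]
    (hp : ∀ n : ℤ, p {n} ≠ 1) :
    ∃ c : ℝ, 0 < c ∧ ∃ L : ℕ, 1 ≤ L ∧ ∀ t, ‖charInt p t‖ ≤ 1 - c * ‖L • t‖ ^ 2 := by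
  obtain ⟨n, hn⟩ : ∃ n, p {n} ≠ 0 := by
    by_contra! h
    have : p = 0 := Measure.ext_of_singleton (by simpa using h)
    exact IsProbabilityMeasure.ne_zero p this
  obtain ⟨m, hmn, hm⟩ : ∃ m, m ≠ n ∧ p {m} ≠ 0 := by
    by_contra! h
    have h0 : p {n}ᶜ = 0 := by
      rw [measure_null_iff_singleton (Set.to_countable _)]
      exact fun m hm => h m hm
    exact hp n ((prob_compl_eq_zero_iff (measurableSet_singleton n)).mp h0)
  -- the common part of the two atoms supplies the cancellation, the rest is bounded trivially
  set c := min (p.real {n}) (p.real {m}) with hc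
  have hc0 : 0 < c := lt_min (ENNReal.toReal_pos hn (measure_ne_top _ _))
    (ENNReal.toReal_pos hm (measure_ne_top _ _))
  refine ⟨4 * c, by positivity, (n - m).natAbs, by omega, fun t => ?_⟩
  have hnorm : ‖(n - m).natAbs • t‖ = ‖(n - m) • t‖ := by
    rcases Int.natAbs_eq (n - m) with h | h
    · conv_rhs => rw [h, natCast_zsmul]
    · conv_rhs => rw [h, neg_smul, norm_neg, natCast_zsmul]
  have hint : Integrable (fun z : ℤ => (fourier z t : ℂ)) p :=
    (integrable_const (1 : ℝ)).mono' (by fun_prop)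
      (Filter.Eventually.of_forall fun z => (norm_fourier_apply z t).le)
  set S : Finset ℤ := {n, m} with hS
  have hsum : ∫ z in (S : Set ℤ), (fourier z t : ℂ) ∂p =
      p.real {n} * fourier n t + p.real {m} * fourier m t := by
    rw [setIntegral_finset _ hint.integrableOn, hS, Finset.sum_pair hmn.symm]
    simp
  have hSm : p.real (S : Set ℤ) = p.real {n} + p.real {m} := by
    rw [← sum_measureReal_singleton, hS, Finset.sum_pair hmn.symm]
  have hcompl : ‖∫ z in (S : Set ℤ)ᶜ, (fourier z t : ℂ) ∂p‖ ≤ 1 - (p.real {n} + p.real {m}) := by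
    refine (norm_setIntegral_le_of_norm_le_const (measure_lt_top _ _)
      fun z _ => (norm_fourier_apply z t).le).trans_eq ?_
    rw [one_mul, measureReal_compl S.measurableSet, hSm]; simp
  have hpair : ‖(p.real {n} * fourier n t + p.real {m} * fourier m t : ℂ)‖ ≤
      p.real {n} + p.real {m} - 2 * c + c * (2 - 4 * ‖(n - m) • t‖ ^ 2) := by
    have e : (p.real {n} * fourier n t + p.real {m} * fourier m t : ℂ) =
        ((p.real {n} - c : ℝ) * fourier n t + (p.real {m} - c : ℝ) * fourier m t) +
          c * (fourier n t + fourier m t) := by push_cast; ring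
    rw [e]
    have h1 : ‖((p.real {n} - c : ℝ) * fourier n t : ℂ)‖ = p.real {n} - c := by
      rw [norm_mul, norm_fourier_apply, mul_one, Complex.norm_real, Real.norm_of_nonneg]
      exact sub_nonneg.mpr (min_le_left _ _)
    have h2 : ‖((p.real {m} - c : ℝ) * fourier m t : ℂ)‖ = p.real {m} - c := by
      rw [norm_mul, norm_fourier_apply, mul_one, Complex.norm_real, Real.norm_of_nonneg]
      exact sub_nonneg.mpr (min_le_right _ _)
    have h3 : ‖(c * (fourier n t + fourier m t) : ℂ)‖ ≤ c * (2 - 4 * ‖(n - m) • t‖ ^ 2) := by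
      rw [norm_mul, Complex.norm_real, Real.norm_of_nonneg hc0.le]
      gcongr
      exact norm_fourier_add_le n m t
    calc _ ≤ _ := (norm_add_le _ _).trans (add_le_add (norm_add_le _ _) h3)
      _ = _ := by rw [h1, h2]; ring
  rw [hnorm, charInt, ← integral_add_compl S.measurableSet hint, hsum]
  refine (norm_add_le _ _).trans ((add_le_add hpair hcompl).trans_eq ?_)
  ring

/-- A common lattice parameter `L` serves all coordinates, at the price of a smaller constant. -/
lemma exists_norm_sum_charInt_le {r : ℕ} (p : Fin r → Measure ℤ)
    [∀ i, IsProbabilityMeasure (p i)] (q : Measure (Fin r)) [IsProbabilityMeasure q]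
    (hp : ∀ i, ∀ n : ℤ, p i {n} ≠ 1) (hq : ∀ i, 0 < q {i}) :
    ∃ c : ℝ, 0 < c ∧ ∃ L : ℕ, 1 ≤ L ∧ ∀ t : Fin r → UnitAddCircle,
      ‖∑ i, (q.real {i} : ℂ) * charInt (p i) (t i)‖ ≤ Real.exp (-(c * ∑ i, ‖L • t i‖ ^ 2)) := by
  choose c hc L hL h using fun i => exists_norm_charInt_le (p i) (hp i)
  have hqr (i) : 0 < q.real {i} := ENNReal.toReal_pos (hq i).ne' (measure_ne_top _ _)
  set Λ : ℕ := ∏ i, L i with hΛ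
  have hΛ1 : 1 ≤ Λ := Finset.one_le_prod' fun i _ => hL i
  have hΛ0 : (0 : ℝ) < Λ := by exact_mod_cast hΛ1
  obtain ⟨c', hc', hcc⟩ : ∃ c' : ℝ, 0 < c' ∧ ∀ i, c' ≤ q.real {i} * c i / Λ ^ 2 := by
    have hpos (i) : 0 < q.real {i} * c i / (Λ : ℝ) ^ 2 := by
      have := hqr i; have := hc i; positivity
    rcases isEmpty_or_nonempty (Fin r) with he | he
    · exact ⟨1, one_pos, fun i => he.elim i⟩
    · obtain ⟨i, hi⟩ := Finite.exists_min fun i => q.real {i} * c i / (Λ : ℝ) ^ 2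
      exact ⟨_, hpos i, hi⟩
  refine ⟨c', hc', Λ, hΛ1, fun t => ?_⟩
  have hΛt (i) : ‖Λ • t i‖ ≤ Λ * ‖L i • t i‖ := by
    obtain ⟨N, hN⟩ := Finset.dvd_prod_of_mem L (Finset.mem_univ i)
    have hN' : Λ = N * L i := by rw [hΛ, hN, mul_comm]
    have hNle : N ≤ Λ := by rw [hN']; exact Nat.le_mul_of_pos_right _ (hL i)
    calc ‖Λ • t i‖ = ‖N • (L i • t i)‖ := by rw [hN', mul_smul]
      _ ≤ N * ‖L i • t i‖ := norm_nsmul_le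
      _ ≤ _ := by gcongr
  have hone : ∑ i, q.real {i} = 1 := by
    rw [sum_measureReal_singleton]; simp
  calc _ ≤ ∑ i, q.real {i} * (1 - c i * ‖L i • t i‖ ^ 2) := by
        refine (norm_sum_le _ _).trans (Finset.sum_le_sum fun i _ => ?_)
        rw [norm_mul, Complex.norm_real, Real.norm_of_nonneg (hqr i).le]
        exact mul_le_mul_of_nonneg_left (h i _) (hqr i).le
    _ = 1 - ∑ i, q.real {i} * c i * ‖L i • t i‖ ^ 2 := by
        simp_rw [mul_sub, mul_one, Finset.sum_sub_distrib, hone, mul_assoc]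
    _ ≤ 1 - c' * ∑ i, ‖Λ • t i‖ ^ 2 := by
        rw [Finset.mul_sum]
        refine sub_le_sub_left (Finset.sum_le_sum fun i _ => ?_) _
        calc c' * ‖Λ • t i‖ ^ 2 ≤ q.real {i} * c i / Λ ^ 2 * (Λ * ‖L i • t i‖) ^ 2 := by
              gcongr
              · exact hc'.le.trans (hcc i)
              · exact hcc i
              · exact hΛt i
          _ = _ := by field_simp
    _ ≤ _ := by
        have := Real.add_one_le_exp (-(c' * ∑ i, ‖Λ • t i‖ ^ 2))
        linarith

/-- The class of `⟨h, a⟩` modulo `1`. -/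
def pairing {d : ℕ} (a : Fin d → ℝ) (h : Fin d → ℤ) : UnitAddCircle :=
  ((∑ j, (h j : ℝ) * a j : ℝ) : UnitAddCircle)

lemma mFourier_toTorus {d : ℕ} (h : Fin d → ℤ) (z : ℤ) (a : Fin d → ℝ) :
    mFourier h (toTorus (z • a)) = fourier z (pairing a h) := by
  simp only [mFourier, ContinuousMap.coe_mk, toTorus, fourier_coe_apply, pairing, Pi.smul_apply]
  rw [← Complex.exp_sum]
  congr 1
  push_cast
  rw [Finset.mul_sum, Finset.sum_div]
  refine Finset.sum_congr rfl fun j _ => ?_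
  simp; ring

lemma charCoeff_step {d r : ℕ} (p : Fin r → Measure ℤ)
    [∀ i, IsProbabilityMeasure (p i)] (q : Measure (Fin r)) [IsProbabilityMeasure q]
    {Ω : Type*} [MeasurableSpace Ω] (P : Measure Ω) [IsProbabilityMeasure P]
    (ξ : Fin r → Ω → ℤ) (I : Ω → Fin r) (hξ : ∀ i, HasLaw (ξ i) (p i) P) (hI : HasLaw I q P)
    (hind : IndepFun (fun ω i => ξ i ω) I P) (α : Fin r → Fin d → ℝ)
    (ν : Measure (UnitAddTorus (Fin d)))
    (hν : HasLaw (fun ω => toTorus (ξ (I ω) ω • α (I ω))) ν P) (h : Fin d → ℤ) :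
    charCoeff ν h = ∑ i, (q.real {i} : ℂ) * charInt (p i) (pairing (α i) h) := by
  have hξm : AEMeasurable (fun ω i => ξ i ω) P :=
    aemeasurable_pi_lambda _ fun i => (hξ i).aemeasurable
  set F : (Fin r → ℤ) × Fin r → ℂ := fun z => fourier (z.1 z.2) (pairing (α z.2) h) with hF
  have hFm : Measurable F := measurable_from_prod_countable_left fun i => by
    simp only [hF]; fun_prop
  have h1 : charCoeff ν h = ∫ ω, F (fun i => ξ i ω, I ω) ∂P := by
    rw [charCoeff, ← hν.integral_comp (mFourier h).continuous.aestronglyMeasurable]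
    simp only [Function.comp_def, mFourier_toTorus, hF]
  have hprod := (indepFun_iff_map_prod_eq_prod_map_map hξm hI.aemeasurable).mp hind
  have hfin : IsProbabilityMeasure (P.map fun ω i => ξ i ω) := Measure.isProbabilityMeasure_map hξm
  have hFi : Integrable F ((P.map fun ω i => ξ i ω).prod q) :=
    (integrable_const (1 : ℝ)).mono' hFm.aestronglyMeasurable
      (Filter.Eventually.of_forall fun z => (norm_fourier_apply _ _).le)
  rw [h1, ← integral_map (φ := fun ω => ((fun i => ξ i ω), I ω)) (hξm.prodMk hI.aemeasurable)
    hFm.aestronglyMeasurable, hprod, hI.map_eq, integral_prod_symm _ hFi,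
    integral_fintype (Integrable.of_finite)]
  refine Finset.sum_congr rfl fun i _ => ?_
  rw [Complex.real_smul]
  congr 1
  rw [integral_map hξm (by
    exact (hFm.comp (measurable_id.prodMk measurable_const)).aestronglyMeasurable), charInt,
    ← (hξ i).integral_comp (by fun_prop)]
  rfl

instance isProbabilityMeasure_convPow {d : ℕ} (ν : Measure (UnitAddTorus (Fin d)))
    [IsProbabilityMeasure ν] (k : ℕ) : IsProbabilityMeasure (convPow ν k) := by
  induction k with
  | zero => rw [convPow]; infer_instance
  | succ k ih => rw [convPow]; infer_instance

lemma charCoeff_convPow {d : ℕ} (ν : Measure (UnitAddTorus (Fin d)))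
    [IsProbabilityMeasure ν] (k : ℕ) (h : Fin d → ℤ) :
    charCoeff (convPow ν k) h = charCoeff ν h ^ k := by
  induction k with
  | zero =>
    rw [convPow, charCoeff, integral_dirac, pow_zero]
    simp [mFourier]
  | succ k ih => rw [convPow, charCoeff_conv, ih, pow_succ]

end CharacteristicFunction

/-! ### Gaussian sums over separated points -/

section Counting

/-- The sum over all cells of a one-dimensional grid of a bound for a Gaussian on the cell. -/
def cellSum (w : ℝ) : ℝ := ∑' m : ℤ, Real.exp (-(w * (|(m : ℝ)| - 1)))

lemma summable_cell {w : ℝ} (hw : 0 < w) :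
    Summable fun m : ℤ => Real.exp (-(w * (|(m : ℝ)| - 1))) := by
  have h : Summable fun n : ℕ => Real.exp (-(w * ((n : ℝ) - 1))) := by
    have h1 := (Real.summable_exp_nat_mul_iff.mpr (neg_lt_zero.mpr hw)).mul_left (Real.exp w)
    refine h1.congr fun n => ?_
    rw [← Real.exp_add]
    congr 1; ring
  refine Summable.of_nat_of_neg ?_ ?_ <;> simpa using h

lemma cellSum_nonneg (w : ℝ) : 0 ≤ cellSum w := tsum_nonneg fun _ => (Real.exp_pos _).le

lemma exp_neg_sq_le_cell {δ s w x : ℝ} (hδ : 0 < δ) (hw : 0 < w) (hs : w ≤ s * δ ^ 2) :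
    Real.exp (-(s * x ^ 2)) ≤ Real.exp (-(w * (|(⌊x / δ⌋ : ℝ)| - 1))) := by
  refine Real.exp_le_exp.mpr (neg_le_neg ?_)
  set m := ⌊x / δ⌋ with hm
  have hx : x ^ 2 = δ ^ 2 * (x / δ) ^ 2 := by field_simp
  have h1 := Int.floor_le (x / δ)
  have h2 := Int.lt_floor_add_one (x / δ)
  rw [← hm] at h1 h2
  have hkey : |(m : ℝ)| - 1 ≤ (x / δ) ^ 2 := by
    rcases le_or_gt |m| 0 with h0 | h0
    · have : m = 0 := abs_nonpos_iff.mp h0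
      rw [this]; simp; nlinarith [sq_nonneg (x / δ)]
    · have h3 : (1 : ℤ) ≤ |m| := h0
      have h4 : |m| - 1 ≤ (|m| - 1) ^ 2 := Int.le_self_sq _
      have h5 : |(m : ℝ)| - 1 ≤ (|(m : ℝ)| - 1) ^ 2 := by exact_mod_cast h4
      have h6 : (0 : ℝ) ≤ |(m : ℝ)| - 1 := by
        have : (1 : ℝ) ≤ |(m : ℝ)| := by exact_mod_cast h3
        linarith
      have h7 : |(m : ℝ)| - 1 ≤ |x / δ| := by
        rcases le_or_gt 0 m with h | h
        · rw [abs_of_nonneg (by exact_mod_cast h : (0 : ℝ) ≤ m)]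
          linarith [le_abs_self (x / δ)]
        · rw [abs_of_neg (by exact_mod_cast h : (m : ℝ) < 0)]
          linarith [neg_le_abs (x / δ)]
      calc |(m : ℝ)| - 1 ≤ (|(m : ℝ)| - 1) ^ 2 := h5
        _ ≤ |x / δ| ^ 2 := by gcongr
        _ = _ := sq_abs _
  calc w * (|(m : ℝ)| - 1) ≤ w * (x / δ) ^ 2 := by gcongr
    _ ≤ s * δ ^ 2 * (x / δ) ^ 2 := by gcongr
    _ = s * x ^ 2 := by rw [hx]; ring

lemma norm_coe_circle_le (s : ℝ) : ‖(s : UnitAddCircle)‖ ≤ |s| :=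
  QuotientAddGroup.norm_mk_le_norm

/-- A Gaussian sum over a `δ`-separated set of points is bounded independently of the
set, provided the Gaussian has width at most of order `δ`: each cell of a grid with mesh `δ`
contains at most one of the points. -/
lemma sum_exp_le_of_separated_real {A : Type*} (S : Finset A) {r : ℕ}
    (y : A → Fin r → ℝ) {δ s w : ℝ} (hδ : 0 < δ) (hw : 0 < w) (hs : w ≤ s * δ ^ 2)
    (hsep : ∀ a ∈ S, ∀ b ∈ S, a ≠ b → ∃ i, δ ≤ |y a i - y b i|) :
    ∑ a ∈ S, Real.exp (-(s * ∑ i, y a i ^ 2)) ≤ cellSum w ^ r := by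
  let m : A → Fin r → ℤ := fun a i => ⌊y a i / δ⌋
  have hinj : Set.InjOn m S := by
    intro a ha b hb hab
    by_contra hne
    obtain ⟨i, hi⟩ := hsep a ha b hb hne
    have h1 := Int.abs_sub_lt_one_of_floor_eq_floor (congrFun hab i)
    rw [← sub_div, abs_div, abs_of_pos hδ, div_lt_one hδ] at h1
    linarith
  let g : ℤ → ℝ := fun m => Real.exp (-(w * (|(m : ℝ)| - 1)))
  have hg0 (z) : 0 ≤ g z := (Real.exp_pos _).le
  calc _ ≤ ∑ a ∈ S, ∏ i, g (m a i) := by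
        refine Finset.sum_le_sum fun a _ => ?_
        rw [Finset.mul_sum, ← Finset.sum_neg_distrib, Real.exp_sum]
        exact Finset.prod_le_prod (fun i _ => (Real.exp_pos _).le)
          fun i _ => exp_neg_sq_le_cell hδ hw hs
    _ = ∑ f ∈ S.image m, ∏ i, g (f i) := by rw [Finset.sum_image hinj]
    _ ≤ ∑ f ∈ Fintype.piFinset fun i => S.image fun a => m a i, ∏ i, g (f i) := by
        refine Finset.sum_le_sum_of_subset_of_nonneg ?_ fun f _ _ =>
          Finset.prod_nonneg fun i _ => hg0 _
        intro f hf
        obtain ⟨a, ha, rfl⟩ := Finset.mem_image.mp hf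
        exact Fintype.mem_piFinset.mpr fun i => Finset.mem_image_of_mem _ ha
    _ = ∏ i : Fin r, ∑ z ∈ S.image fun a => m a i, g z :=
        (Finset.prod_univ_sum (fun i => S.image fun a => m a i) fun _ z => g z).symm
    _ ≤ ∏ _i : Fin r, cellSum w :=
        Finset.prod_le_prod (fun i _ => Finset.sum_nonneg fun z _ => hg0 z)
          fun i _ => (summable_cell hw).sum_le_tsum _ fun z _ => hg0 z
    _ = _ := by simp

lemma sum_exp_le_of_separated {A : Type*} (S : Finset A) {r : ℕ}
    (y : A → Fin r → UnitAddCircle) {δ s w : ℝ} (hδ : 0 < δ) (hw : 0 < w) (hs : w ≤ s * δ ^ 2)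
    (hsep : ∀ a ∈ S, ∀ b ∈ S, a ≠ b → ∃ i, δ ≤ ‖y a i - y b i‖) :
    ∑ a ∈ S, Real.exp (-(s * ∑ i, ‖y a i‖ ^ 2)) ≤ cellSum w ^ r := by
  choose lift hlift habs using exists_coe_eq_abs_eq
  simp_rw [← habs, sq_abs]
  refine sum_exp_le_of_separated_real S (fun a i => lift (y a i)) hδ hw hs ?_
  intro a ha b hb hne
  obtain ⟨i, hi⟩ := hsep a ha b hb hne
  have h3 := norm_coe_circle_le (lift (y a i) - lift (y b i))
  rw [AddCircle.coe_sub, hlift, hlift] at h3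
  exact ⟨i, hi.trans h3⟩

end Counting

/-! ### Exponential sums under the Diophantine condition -/

section Diophantine

variable {d r : ℕ}

lemma pairing_sub (a : Fin d → ℝ) (h h' : Fin d → ℤ) :
    pairing a (h - h') = pairing a h - pairing a h' := by
  rw [pairing, pairing, pairing, ← AddCircle.coe_sub, ← Finset.sum_sub_distrib]
  simp [sub_mul]

lemma pairing_nsmul (a : Fin d → ℝ) (L : ℕ) (h : Fin d → ℤ) :
    pairing a (L • h) = L • pairing a h := by
  rw [pairing, pairing, ← AddCircle.coe_nsmul]
  congr 1
  rw [Finset.smul_sum]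
  refine Finset.sum_congr rfl fun j _ => ?_
  simp [mul_assoc]

lemma one_le_norm_of_ne_zero {h : Fin d → ℤ} (h0 : h ≠ 0) : 1 ≤ ‖h‖ := by
  obtain ⟨j, hj⟩ := Function.ne_iff.mp h0
  refine le_trans ?_ (norm_le_pi_norm h j)
  rw [Int.norm_eq_abs]
  exact_mod_cast Int.one_le_abs hj

variable {α : Fin r → Fin d → ℝ} {ψ : ℝ → ℝ}

lemma le_rpow_mul_of_monotoneOn {a : ℝ}
    (hmono : MonotoneOn (fun x => ψ x * x ^ (-a)) (Set.Ici 1)) {x y : ℝ} (hx : 1 ≤ x)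
    (hxy : x ≤ y) : ψ x ≤ (x / y) ^ a * ψ y := by
  have hx0 : 0 < x := by linarith
  have hy0 : 0 < y := by linarith
  have h := hmono (Set.mem_Ici.mpr hx) (Set.mem_Ici.mpr (hx.trans hxy)) hxy
  simp only [Real.rpow_neg hx0.le, Real.rpow_neg hy0.le] at h
  rw [← div_eq_mul_inv, div_le_iff₀ (Real.rpow_pos_of_pos hx0 _)] at h
  rw [Real.div_rpow hx0.le hy0.le]
  refine h.trans_eq ?_
  field_simp

lemma le_of_monotoneOn {a : ℝ} (ha : 0 ≤ a) (hψ : ∀ x, 1 ≤ x → 0 < ψ x)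
    (hmono : MonotoneOn (fun x => ψ x * x ^ (-a)) (Set.Ici 1)) {x y : ℝ} (hx : 1 ≤ x)
    (hxy : x ≤ y) : ψ x ≤ ψ y := by
  refine (le_rpow_mul_of_monotoneOn hmono hx hxy).trans ?_
  refine mul_le_of_le_one_left (hψ y (hx.trans hxy)).le (Real.rpow_le_one ?_ ?_ ha)
  · exact div_nonneg (by linarith) (by linarith)
  · exact div_le_one_of_le₀ hxy (by linarith)

lemma exists_le_norm_pairing (hr : 1 ≤ r) {a : ℝ} (ha : 0 ≤ a) (hψ : ∀ x, 1 ≤ x → 0 < ψ x)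
    (hmono : MonotoneOn (fun x => ψ x * x ^ (-a)) (Set.Ici 1)) {h : Fin d → ℤ} (h0 : h ≠ 0)
    {X : ℝ} (hX : ‖h‖ ≤ X) :
    ∃ i, diophInf α ψ / ψ X ≤ ‖pairing (α i) h‖ := by
  have : Nonempty (Fin r) := ⟨⟨0, hr⟩⟩
  have h1 := one_le_norm_of_ne_zero h0
  obtain ⟨i, hi⟩ := exists_eq_ciSup_of_finite (f := fun i => ‖pairing (α i) h‖)
  refine ⟨i, ?_⟩
  have hb : BddBelow (Set.range fun h : {h : Fin d → ℤ // h ≠ 0} =>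
      (⨆ i, ‖pairing (α i) h.1‖) * ψ ‖h.1‖) := by
    refine ⟨0, ?_⟩
    rintro _ ⟨⟨h, h0⟩, rfl⟩
    exact mul_nonneg (Real.iSup_nonneg fun i => norm_nonneg _)
      (hψ _ (one_le_norm_of_ne_zero h0)).le
  have h2 : diophInf α ψ ≤ (⨆ i, ‖pairing (α i) h‖) * ψ ‖h‖ := ciInf_le hb ⟨h, h0⟩
  rw [← hi] at h2
  rw [div_le_iff₀ (hψ X (h1.trans hX))]
  exact h2.trans (mul_le_mul_of_nonneg_left (le_of_monotoneOn ha hψ hmono h1 hX) (norm_nonneg _))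

lemma exp_neg_le_factorial_div (n : ℕ) {v : ℝ} (hv : 0 < v) :
    Real.exp (-v) ≤ n.factorial / v ^ n := by
  rw [Real.exp_neg, inv_le_comm₀ (Real.exp_pos _) (by positivity), inv_div]
  exact Real.pow_div_factorial_le_exp v hv.le n

/-- The square of the `ℓ²` norm of a Gaussian in the Diophantine data over the frequencies up to
`H` decays like a power of the ratio of `H` to the critical scale `M`, at which
`ψ M ≤ √k`. -/
lemma sum_freqBox_exp_le (hd : 1 ≤ d) (hr : 1 ≤ r) {c K : ℝ} (hc : 0 < c) (hK : 0 < K) {L : ℕ}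
    (hL : 1 ≤ L) (hψ : ∀ x, 1 ≤ x → 0 < ψ x)
    (hmono : MonotoneOn (fun x => ψ x * x ^ (-((d : ℝ) / r))) (Set.Ici 1))
    (hα : diophInf α ψ = K) {k : ℕ} (hk : 1 ≤ k) {M : ℝ} (hM : ψ M ≤ √k) {H : ℕ} (hH : 1 ≤ H)
    (hHM : 2 * L * H ≤ M) :
    ∑ h ∈ freqBox (Fin d) H, Real.exp (-(2 * (c * k) * ∑ i, ‖L • pairing (α i) h‖ ^ 2)) ≤
      (2 * r).factorial / (c * K ^ 2) ^ (2 * r) * cellSum (c * K ^ 2) ^ r *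
        (2 * L * H / M) ^ 4 := by
  set X : ℝ := 2 * L * H with hX
  set a : ℝ := (d : ℝ) / r with ha
  have hL' : (1 : ℝ) ≤ L := by exact_mod_cast hL
  have hH' : (1 : ℝ) ≤ H := by exact_mod_cast hH
  have hk' : (0 : ℝ) < k := by exact_mod_cast hk
  have hr' : (r : ℝ) ≠ 0 := by positivity
  have ha0 : 0 ≤ a := by positivity
  have hX1 : 1 ≤ X := by rw [hX]; nlinarith
  have hM0 : 0 < M := by linarith
  have hψX := hψ X hX1
  set δ := K / ψ X with hδ
  have hδ0 : 0 < δ := by positivity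
  set θ := X / M with hθ
  have hθ0 : 0 < θ := by positivity
  have hθ1 : θ ≤ 1 := div_le_one_of_le₀ hHM hM0.le
  have hθa : 0 < θ ^ a := Real.rpow_pos_of_pos hθ0 a
  have hψX2 : ψ X ^ 2 ≤ (θ ^ a) ^ 2 * k := by
    calc ψ X ^ 2 ≤ (θ ^ a * √k) ^ 2 := by
          gcongr
          exact (le_rpow_mul_of_monotoneOn hmono hX1 hHM).trans (by gcongr)
      _ = _ := by rw [mul_pow, Real.sq_sqrt hk'.le]
  -- the width of the Gaussian is at most of order `δ`, with the ratio gaining a power of `θ`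
  have hkδ : c * K ^ 2 / (θ ^ a) ^ 2 ≤ c * k * δ ^ 2 := by
    rw [hδ, div_pow, mul_div_assoc', div_le_div_iff₀ (by positivity) (by positivity)]
    calc c * K ^ 2 * ψ X ^ 2 ≤ c * K ^ 2 * ((θ ^ a) ^ 2 * k) := by gcongr
      _ = _ := by ring
  have hw : c * K ^ 2 ≤ c * k * δ ^ 2 := by
    refine le_trans ?_ hkδ
    rw [le_div_iff₀ (by positivity)]
    refine mul_le_of_le_one_right (by positivity) ?_
    exact pow_le_one₀ hθa.le (Real.rpow_le_one hθ0.le hθ1 ha0)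
  have hbox {h : Fin d → ℤ} (h0 : h ≠ 0) (hh : ∀ j, |h j| ≤ 2 * H) :
      ∃ i, δ ≤ ‖L • pairing (α i) h‖ := by
    have hne : L • h ≠ 0 := smul_ne_zero (by omega) h0
    have hnorm : ‖L • h‖ ≤ X := by
      refine (pi_norm_le_iff_of_nonneg (by linarith)).mpr fun j => ?_
      have : |(h j : ℝ)| ≤ 2 * H := by exact_mod_cast hh j
      rw [Pi.smul_apply, nsmul_eq_mul, norm_mul, Int.norm_eq_abs, Int.norm_eq_abs]
      push_cast
      rw [abs_of_nonneg (by linarith : (0 : ℝ) ≤ L), hX]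
      nlinarith
    obtain ⟨i, hi⟩ := exists_le_norm_pairing (α := α) hr ha0 hψ hmono hne hnorm
    rw [hα, pairing_nsmul] at hi
    exact ⟨i, hi⟩
  have hsum : ∑ h ∈ freqBox (Fin d) H, Real.exp (-(c * k * ∑ i, ‖L • pairing (α i) h‖ ^ 2)) ≤
      cellSum (c * K ^ 2) ^ r := by
    refine sum_exp_le_of_separated _ (fun h i => L • pairing (α i) h) hδ0 (by positivity) hw ?_
    intro h hh h' hh' hne
    rw [mem_freqBox] at hh hh'
    obtain ⟨i, hi⟩ := hbox (sub_ne_zero.mpr hne) fun j => by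
      have h1 := hh.2 j
      have h2 := hh'.2 j
      rw [Pi.sub_apply]
      rw [abs_lt] at h1 h2
      exact abs_le.mpr ⟨by linarith, by linarith⟩
    refine ⟨i, hi.trans_eq ?_⟩
    rw [pairing_sub, smul_sub]
  have hexp : Real.exp (-(c * k * δ ^ 2)) ≤
      (2 * r).factorial / (c * K ^ 2) ^ (2 * r) * θ ^ 4 := by
    have hθr : (θ ^ a) ^ r = θ ^ d := by
      rw [← Real.rpow_natCast (θ ^ a), ← Real.rpow_mul hθ0.le, ha, div_mul_cancel₀ _ hr',
        Real.rpow_natCast]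
    calc _ ≤ Real.exp (-(c * K ^ 2 / (θ ^ a) ^ 2)) := Real.exp_le_exp.mpr (neg_le_neg hkδ)
      _ ≤ (2 * r).factorial / (c * K ^ 2 / (θ ^ a) ^ 2) ^ (2 * r) :=
          exp_neg_le_factorial_div _ (by positivity)
      _ = (2 * r).factorial / (c * K ^ 2) ^ (2 * r) * ((θ ^ a) ^ r) ^ 4 := by
          rw [div_pow, ← pow_mul, ← pow_mul]
          have : 2 * (2 * r) = r * 4 := by ring
          rw [this]; field_simp
      _ = (2 * r).factorial / (c * K ^ 2) ^ (2 * r) * (θ ^ 4) ^ d := by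
          rw [hθr, ← pow_mul, ← pow_mul, mul_comm d]
      _ ≤ _ := by
          gcongr
          exact pow_le_of_le_one (by positivity) (pow_le_one₀ hθ0.le hθ1) (by omega)
  calc _ ≤ ∑ h ∈ freqBox (Fin d) H, Real.exp (-(c * k * δ ^ 2)) *
        Real.exp (-(c * k * ∑ i, ‖L • pairing (α i) h‖ ^ 2)) := by
        refine Finset.sum_le_sum fun h hh => ?_
        rw [← Real.exp_add]
        refine Real.exp_le_exp.mpr ?_
        rw [mem_freqBox] at hh
        obtain ⟨i, hi⟩ := hbox hh.1 fun j => by have := hh.2 j; omega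
        have h1 : δ ^ 2 ≤ ∑ i, ‖L • pairing (α i) h‖ ^ 2 :=
          (pow_le_pow_left₀ hδ0.le hi 2).trans (Finset.single_le_sum
            (f := fun i => ‖L • pairing (α i) h‖ ^ 2) (fun _ _ => sq_nonneg _) (Finset.mem_univ i))
        have h2 : c * k * δ ^ 2 ≤ c * k * ∑ i, ‖L • pairing (α i) h‖ ^ 2 := by gcongr
        linarith
    _ = Real.exp (-(c * k * δ ^ 2)) * ∑ h ∈ freqBox (Fin d) H,
          Real.exp (-(c * k * ∑ i, ‖L • pairing (α i) h‖ ^ 2)) := (Finset.mul_sum _ _ _).symm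
    _ ≤ (2 * r).factorial / (c * K ^ 2) ^ (2 * r) * θ ^ 4 * cellSum (c * K ^ 2) ^ r := by
        gcongr
    _ = _ := by ring

lemma bddAbove_genInv {a : ℝ} (ha : 0 < a) (hψ : ∀ x, 1 ≤ x → 0 < ψ x)
    (hmono : MonotoneOn (fun x => ψ x * x ^ (-a)) (Set.Ici 1)) (y : ℝ) :
    BddAbove (insert 1 {x : ℝ | 1 ≤ x ∧ ψ x ≤ y}) := by
  refine BddAbove.insert _ ⟨(y / ψ 1) ^ a⁻¹, ?_⟩
  rintro x ⟨hx, hxy⟩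
  have hx0 : 0 < x := by linarith
  have h1 := hψ 1 le_rfl
  have h := le_rpow_mul_of_monotoneOn hmono le_rfl hx
  rw [Real.div_rpow zero_le_one hx0.le, Real.one_rpow, one_div_mul_eq_div,
    le_div_iff₀ (Real.rpow_pos_of_pos hx0 _)] at h
  have h2 : x ^ a ≤ y / ψ 1 := by
    rw [le_div_iff₀ h1]; linarith
  calc x = (x ^ a) ^ a⁻¹ := (Real.rpow_rpow_inv hx0.le ha.ne').symm
    _ ≤ _ := by gcongr

end Diophantine

/-! ### The rate of convergence -/

section Walk

variable {d r : ℕ}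

/-- The convergence rate, for a step distribution given by a Gaussian bound on its Fourier
coefficients. -/
lemma exists_W1_convPow_le (hd : 1 ≤ d) (hr : 1 ≤ r) {c : ℝ} (hc : 0 < c) {L : ℕ} (hL : 1 ≤ L)
    (K : ℝ) :
    ∃ C : ℝ, 0 ≤ C ∧ ∀ (α : Fin r → Fin d → ℝ) (ν : Measure (UnitAddTorus (Fin d))),
      IsProbabilityMeasure ν →
      (∀ h, ‖charCoeff ν h‖ ≤ Real.exp (-(c * ∑ i, ‖L • pairing (α i) h‖ ^ 2))) →
      ∀ ψ : ℝ → ℝ, (∀ x, 1 ≤ x → 0 < ψ x) →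
        MonotoneOn (fun x => ψ x * x ^ (-((d : ℝ) / r))) (Set.Ici 1) →
        0 < diophInf α ψ → diophInf α ψ = K → ∀ k : ℕ, 1 ≤ k →
          W1 (convPow ν k) volume ≤ C / genInv ψ √k := by
  set B : ℝ := (2 * r).factorial / (c * K ^ 2) ^ (2 * r) * cellSum (c * K ^ 2) ^ r with hB
  have hB0 : 0 ≤ B := by have := cellSum_nonneg (c * K ^ 2); positivity
  have hL' : (1 : ℝ) ≤ L := by exact_mod_cast hL
  have hd' : (1 : ℝ) ≤ d := by exact_mod_cast hd
  refine ⟨√d * (d * (1 + 4 * √B)) * (16 * L), by positivity, ?_⟩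
  intro α ν hprob hν ψ hψ hmono hpos hK k hk
  have hK0 : 0 < K := hK ▸ hpos
  have ha : 0 < (d : ℝ) / r := by
    have : (0 : ℝ) < r := by exact_mod_cast hr
    positivity
  -- boundedness matters: the supremum of an unbounded set of reals is `0` by convention
  have hbdd := bddAbove_genInv ha hψ hmono √k
  set G := genInv ψ √k with hG
  have hG1 : 1 ≤ G := le_csSup hbdd (Set.mem_insert _ _)
  have hdB : 1 ≤ d * (1 + 4 * √B) := by
    have := Real.sqrt_nonneg B
    nlinarith
  rw [le_div_iff₀ (by linarith)]
  rcases lt_or_ge G (8 * L) with hGL | hGL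
  -- below a fixed scale, the trivial bound by the diameter suffices
  · have h1 : transportCost (convPow ν k) volume ≤ ENNReal.ofReal 1 := by
      refine (transportCost_le_diam _ _ (by simp) edist_torus_le_one).trans_eq (by simp)
    have h2 := W1_le_of_transportCost_le zero_le_one h1
    calc _ ≤ √d * 1 * (8 * L) := by gcongr
      _ ≤ √d * (d * (1 + 4 * √B)) * (16 * L) := by gcongr; norm_num
  · obtain ⟨M, hMmem, hGM⟩ := exists_lt_of_lt_csSup (Set.insert_nonempty _ _)
      (show G / 2 < sSup (insert 1 {x : ℝ | 1 ≤ x ∧ ψ x ≤ √k}) from half_lt_self (by linarith))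
    have hM : 1 ≤ M ∧ ψ M ≤ √k := by
      rcases hMmem with rfl | h
      · linarith
      · exact h
    have hM0 : 0 < M := by linarith [hM.1]
    -- the finest scale `2⁻ᴶ` of the smoothing is chosen of order `1 / M`
    obtain ⟨J, hJ1, hJ2⟩ := exists_nat_pow_near (x := M / (4 * L)) (y := 2)
      (by rw [le_div_iff₀ (by positivity)]; linarith) one_lt_two
    rw [le_div_iff₀ (by positivity)] at hJ1
    rw [div_lt_iff₀ (by positivity), pow_succ] at hJ2
    have hP0 : (0 : ℝ) < 2 ^ J := by positivity
    have hscale (j : ℕ) (hj : j < J) :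
        1 / 2 ^ (J - (j + 1)) *
          √(∑ h ∈ freqBox (Fin d) (2 * 2 ^ (J - j)), ‖charCoeff (convPow ν k) h‖ ^ 2) ≤
        2 * √B / 2 ^ J * (1 / 2) ^ j := by
      have e1 : (2 : ℝ) ^ (J - (j + 1)) = 2 ^ J / (2 * 2 ^ j) := by
        rw [eq_div_iff (by positivity), ← pow_succ', ← pow_add]
        congr 1; omega
      have e2 : (2 : ℝ) ^ (J - j) = 2 ^ J / 2 ^ j := by
        rw [eq_div_iff (by positivity), ← pow_add]
        congr 1; omega
      have e3 : 2 * L * ((2 * 2 ^ (J - j) : ℕ) : ℝ) = 2 ^ J * (4 * L) / 2 ^ j := by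
        push_cast; rw [e2]; ring
      have h2j : (1 : ℝ) ≤ 2 ^ j := one_le_pow₀ one_le_two
      have e4 : 2 * L * ((2 * 2 ^ (J - j) : ℕ) : ℝ) ≤ M / 2 ^ j := by rw [e3]; gcongr
      have e5 : 2 * L * ((2 * 2 ^ (J - j) : ℕ) : ℝ) ≤ M := e4.trans (div_le_self hM0.le h2j)
      have e6 := sum_freqBox_exp_le hd hr hc hK0 hL hψ hmono hK hk hM.2
        (Nat.succ_le_of_lt (by positivity)) e5
      have e7 : ∑ h ∈ freqBox (Fin d) (2 * 2 ^ (J - j)), ‖charCoeff (convPow ν k) h‖ ^ 2 ≤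
          B * (((1 / 2) ^ j) ^ 2) ^ 2 := by
        refine le_trans (Finset.sum_le_sum fun h _ => ?_) (e6.trans ?_)
        · rw [charCoeff_convPow, norm_pow]
          calc _ ≤ (Real.exp (-(c * ∑ i, ‖L • pairing (α i) h‖ ^ 2)) ^ k) ^ 2 := by
                gcongr; exact hν h
            _ = _ := by
                rw [← pow_mul, ← Real.exp_nat_mul]
                congr 1; push_cast; ring
        · rw [← pow_mul, ← hB]
          gcongr
          rw [one_div_pow, div_le_iff₀ hM0, one_div_mul_eq_div]
          exact e4
      have e8 : √(∑ h ∈ freqBox (Fin d) (2 * 2 ^ (J - j)), ‖charCoeff (convPow ν k) h‖ ^ 2) ≤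
          √B * ((1 / 2) ^ j) ^ 2 := by
        refine (Real.sqrt_le_sqrt e7).trans_eq ?_
        rw [Real.sqrt_mul hB0, Real.sqrt_sq (by positivity)]
      calc _ ≤ 1 / (2 ^ J / (2 * 2 ^ j)) * (√B * ((1 / 2) ^ j) ^ 2) := by rw [e1]; gcongr
        _ = _ := by
            rw [one_div_pow]
            field_simp
    have hsum : 1 / 2 ^ J + ∑ j ∈ Finset.range J, 1 / 2 ^ (J - (j + 1)) *
        √(∑ h ∈ freqBox (Fin d) (2 * 2 ^ (J - j)), ‖charCoeff (convPow ν k) h‖ ^ 2) ≤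
        (1 + 4 * √B) / 2 ^ J := by
      have hgeo : ∑ j ∈ Finset.range J, (1 / 2 : ℝ) ^ j ≤ 2 := by
        rw [geom_sum_eq (by norm_num)]
        have : (0 : ℝ) ≤ (1 / 2) ^ J := by positivity
        rw [div_le_iff_of_neg (by norm_num)]
        linarith
      calc _ ≤ 1 / 2 ^ J + ∑ j ∈ Finset.range J, 2 * √B / 2 ^ J * (1 / 2) ^ j := by
            exact add_le_add_right (Finset.sum_le_sum fun j hj =>
              hscale j (Finset.mem_range.mp hj)) _
        _ = 1 / 2 ^ J + 2 * √B / 2 ^ J * ∑ j ∈ Finset.range J, (1 / 2 : ℝ) ^ j := by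
            rw [Finset.mul_sum]
        _ ≤ 1 / 2 ^ J + 2 * √B / 2 ^ J * 2 := by gcongr
        _ = _ := by ring
    have hcost := transportCost_volume_le (convPow ν k) J
    rw [Fintype.card_fin] at hcost
    have hW := W1_le_of_transportCost_le (B := d * ((1 + 4 * √B) / 2 ^ J)) (by positivity)
      (hcost.trans (ENNReal.ofReal_le_ofReal (by gcongr)))
    calc _ ≤ √d * (d * ((1 + 4 * √B) / 2 ^ J)) * (2 ^ J * (16 * L)) := by
          gcongr
          linarith
      _ = _ := by field_simp

lemma rpow_le_genInv (hd : 1 ≤ d) (hr : 1 ≤ r) {k : ℕ} (hk : 1 ≤ k)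
    (hbdd : BddAbove (insert 1 {x : ℝ | 1 ≤ x ∧ x ^ ((d : ℝ) / r) ≤ √k})) :
    (k : ℝ) ^ ((r : ℝ) / (2 * d)) ≤ genInv (fun x => x ^ ((d : ℝ) / r)) √k := by
  have hk' : (1 : ℝ) ≤ k := by exact_mod_cast hk
  have hd' : (d : ℝ) ≠ 0 := by positivity
  have hr' : (r : ℝ) ≠ 0 := by positivity
  refine le_csSup hbdd (Set.mem_insert_of_mem _ ⟨Real.one_le_rpow hk' (by positivity), ?_⟩)
  simp only [← Real.rpow_mul (zero_le_one.trans hk'), Real.sqrt_eq_rpow]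
  refine le_of_eq ?_
  congr 1
  field_simp

end Walk

end LatticeWalk

end

theorem theorem4 {d r : ℕ} (hd : 1 ≤ d) (hr : 1 ≤ r)
    -- the distributions of `ξ_1, …, ξ_r` and of `I`
    (p : Fin r → Measure ℤ) [∀ i, IsProbabilityMeasure (p i)]
    (q : Measure (Fin r)) [IsProbabilityMeasure q]
    -- every `ξ_i` is nondegenerate (not almost surely constant), and `P(I = i) > 0`
    (hp : ∀ i, ∀ n : ℤ, p i {n} ≠ 1) (hq : ∀ i, 0 < q {i}) :
    -- the implied constant, as a function of the value of the infimum
    ∃ C : ℝ → ℝ,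
      ∀ (Ω : Type*) [MeasurableSpace Ω] (P : Measure Ω) [IsProbabilityMeasure P]
        (ξ : Fin r → Ω → ℤ) (I : Ω → Fin r),
        (∀ i, HasLaw (ξ i) (p i) P) → HasLaw I q P →
        -- `ξ_1, …, ξ_r, I` are independent
        iIndepFun ξ P → IndepFun (fun ω i => ξ i ω) I P →
        ∀ (α : Fin r → Fin d → ℝ) (ν : Measure (UnitAddTorus (Fin d))),
          -- `ν` is the distribution of the step `ξ_I α_I + ℤ^d`
          HasLaw (fun ω => LatticeWalk.toTorus (ξ (I ω) ω • α (I ω))) ν P →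
          (∀ ψ : ℝ → ℝ, (∀ x, 1 ≤ x → 0 < ψ x) →
            MonotoneOn (fun x => ψ x * x ^ (-((d : ℝ) / r))) (Set.Ici 1) →
            0 < LatticeWalk.diophInf α ψ →
            ∀ k : ℕ, 1 ≤ k →
              LatticeWalk.W1 (LatticeWalk.convPow ν k) volume ≤
                C (LatticeWalk.diophInf α ψ) / LatticeWalk.genInv ψ (Real.sqrt k)) ∧
          (LatticeWalk.IsBadlyApproximable α →
            ∀ k : ℕ, 1 ≤ k →
              LatticeWalk.W1 (LatticeWalk.convPow ν k) volume ≤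
                C (LatticeWalk.diophInf α (fun x => x ^ ((d : ℝ) / r))) *
                  (k : ℝ) ^ (-((r : ℝ) / (2 * d)))) := by
  obtain ⟨c, hc, L, hL, hchar⟩ := LatticeWalk.exists_norm_sum_charInt_le p q hp hq
  choose C hC0 hC using LatticeWalk.exists_W1_convPow_le hd hr hc hL
  refine ⟨C, fun Ω _ P _ ξ I hξ hI _ hind α ν hν => ?_⟩
  have hprob : IsProbabilityMeasure ν := hν.isProbabilityMeasure_iff.mp inferInstance
  have hcoeff (h : Fin d → ℤ) := (LatticeWalk.charCoeff_step p q P ξ I hξ hI hind α ν hν h) ▸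
    hchar fun i => LatticeWalk.pairing (α i) h
  have main (ψ : ℝ → ℝ) (hψ : ∀ x, 1 ≤ x → 0 < ψ x)
      (hmono : MonotoneOn (fun x => ψ x * x ^ (-((d : ℝ) / r))) (Set.Ici 1))
      (hK : 0 < LatticeWalk.diophInf α ψ) (k : ℕ) (hk : 1 ≤ k) :=
    hC _ α ν hprob hcoeff ψ hψ hmono hK rfl k hk
  refine ⟨main, fun hbad k hk => ?_⟩
  have hd' : (0 : ℝ) < d := by exact_mod_cast hd
  have hr' : (0 : ℝ) < r := by exact_mod_cast hr
  have hk' : (0 : ℝ) < k := by exact_mod_cast hk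
  have hψ (x : ℝ) (hx : 1 ≤ x) : 0 < x ^ ((d : ℝ) / r) := Real.rpow_pos_of_pos (by linarith) _
  have hmono : MonotoneOn (fun x : ℝ => x ^ ((d : ℝ) / r) * x ^ (-((d : ℝ) / r))) (Set.Ici 1) := by
    intro x hx y hy _
    have hx0 : (0 : ℝ) < x := zero_lt_one.trans_le hx
    have hy0 : (0 : ℝ) < y := zero_lt_one.trans_le hy
    simp only [← Real.rpow_add hx0, ← Real.rpow_add hy0, add_neg_cancel, Real.rpow_zero, le_refl]
  refine (main _ hψ hmono hbad k hk).trans ?_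
  rw [Real.rpow_neg hk'.le, ← div_eq_mul_inv]
  refine div_le_div_of_nonneg_left (hC0 _) (Real.rpow_pos_of_pos hk' _) ?_
  exact LatticeWalk.rpow_le_genInv hd hr hk
    (LatticeWalk.bddAbove_genInv (div_pos hd' hr') hψ hmono _)
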